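/- **Conventions.** A $k$-graph is a finite $k$-uniform hypergraph; a $2$-edge-colouring colours each edge red or blue, and $H^{\mathrm{red}}$, $H^{\mathrm{blue}}$ are the spanning subgraphs of $H$ formed by the red and the blue edges. For $S\subseteq V(H)$, $d_H(S)$ is the number of $(k-|S|)$-sets $T$ of vertices with $S\cup T\in H$. A $k$-graph $H$ on $n$ vertices is $(\mu,\alpha)$-dense if, for each $1\le i\le k-1$, we have $d_H(S)\ge\mu\binom{n}{k-i}$ for all but at most $\alpha\binom{n}{i}$ of the $i$-sets $S$ of vertices, and $d_H(S)=0$ for all other $i$-sets $S$. Two edges $f,f'$ of $H$ are tightly connected in $H$ if there are edges $e_1=f,e_2,\dots,e_t=f'$ of $H$ with $|e_i\cap e_{i+1}|=k-1$ for all $1\le i<t$; a subgraph of $H$ is tightly connected if any two of its edges are tightly connected in $H$, and a tight component of $H$ is a maximal tightly connected subgraph. A monochromatic tight component is a tight component of $H^{\mathrm{red}}$ or of $H^{\mathrm{blue}}$. A monochromatic tightly connected matching is a (possibly empty) set of pairwise disjoint edges, all of one colour $c$, that is tightly connected in $H^{c}$. A fractional matching of $H$ is a function $\omega:E(H)\to[0,1]$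 with $\sum_{e\ni v}\omega(e)\le1$ for every vertex $v$; its weight is $\sum_{e}\omega(e)$. Let $\mu_k^s(\beta,\varepsilon,n)$ be the largest $\mu$ such that every $2$-edge-coloured $(1-\varepsilon,\varepsilon)$-dense $k$-graph on $n$ vertices contains a fractional matching of weight $\mu$ all of whose edges of non-zero weight have weight at least $\beta$ and lie in (the union of) $s$ monochromatic tight components, and let $\mu_k^s(\beta)=\liminf_{\varepsilon\to0^+}\liminf_{n\to\infty}\mu_k^s(\beta,\varepsilon,n)/n$. **Lemma 7.1.** There are non-decreasing functions $f_1,f_2,f_3:(0,1]\to(0,1]$ such that the following holds for all $0<\eta<1$, all $\alpha,\varepsilon\in(0,1]$ and all positive integers $n$ with $\alpha\le f_1(\eta)$, $\varepsilon\le f_2(\alpha)$ and $1/n\le f_3(\varepsilon)$ (that is, for $1/n\ll\varepsilon\ll\alpha\ll\eta<1$). Every $2$-edge-coloured $(1-\varepsilon,\alpha)$-dense $5$-graph on $n$ vertices contains four vertex-disjoint monochromatic tightly connected matchings whose union covers all but at most $3\eta n$ of the vertices. Moreover, $\mu_5^4(1)\ge\frac15$. -/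

import Mathlib

open Filter Topology

/-- The two colours of a `2`-edge-colouring. -/
inductive Colour : Type
  | red : Colour
  | blue : Colour
  deriving DecidableEq

/-- A `k`-graph (`k`-uniform hypergraph) whose vertex set is the whole type `V`. -/
structure KGraph (V : Type*) (k : ℕ) where
  edges : Finset (Finset V)
  uniform : ∀ e ∈ edges, e.card = k

namespace KGraph

variable {V : Type*} [DecidableEq V] {k : ℕ}

/-- The spanning subgraph `H^c` formed by the edges of colour `c`. A `2`-edge-colouring of `H` is
given by a function `χ` on vertex sets; only its values on the edges of `H` are ever used. -/
def ofColour (H : KGraph V k) (χ : Finset V → Colour) (c : Colour) : KGraph V k where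
  edges := H.edges.filter (fun e => χ e = c)
  uniform := fun e he => H.uniform e (Finset.mem_filter.mp he).1

/-- The neighbourhood `N_H(S)`: all `(k - |S|)`-sets `T` of vertices with `T ∪ S` an edge. -/
def nbhd [Fintype V] (H : KGraph V k) (S : Finset V) : Finset (Finset V) :=
  (Finset.powersetCard (k - S.card) Finset.univ).filter (fun T => T ∪ S ∈ H.edges)

/-- The degree `d_H(S)`. -/
def deg [Fintype V] (H : KGraph V k) (S : Finset V) : ℕ := (H.nbhd S).card

/-- `H` is `(μ, α)`-dense: for each `1 ≤ i ≤ k - 1`, all but at most `α * (n choose i)` of the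
`i`-sets `S` satisfy `d_H(S) ≥ μ * (n choose (k - i))`, and the exceptional ones (those in `E`)
satisfy `d_H(S) = 0`. -/
def IsDense [Fintype V] (H : KGraph V k) (μ α : ℝ) : Prop :=
  ∀ i : ℕ, 1 ≤ i → i < k →
    ∃ E ⊆ Finset.powersetCard i (Finset.univ : Finset V),
      (E.card : ℝ) ≤ α * ((Fintype.card V).choose i : ℝ) ∧
      (∀ S ∈ Finset.powersetCard i (Finset.univ : Finset V), S ∉ E →
        μ * ((Fintype.card V).choose (k - i) : ℝ) ≤ (H.deg S : ℝ)) ∧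
      (∀ S ∈ E, H.deg S = 0)

/-- `e` and `f` are edges of `H` that share exactly `k - 1` vertices. -/
def TightStep (H : KGraph V k) (e f : Finset V) : Prop :=
  e ∈ H.edges ∧ f ∈ H.edges ∧ (e ∩ f).card + 1 = k

/-- The edges `e`, `f` are tightly connected in `H`: some sequence of edges of `H` leads from `e`
to `f`, and any two consecutive edges share exactly `k - 1` vertices. -/
def TightConn (H : KGraph V k) (e f : Finset V) : Prop :=
  e ∈ H.edges ∧ f ∈ H.edges ∧ Relation.ReflTransGen H.TightStep e f

/-- `F` is (the edge set of) a tightly connected subgraph of `H`: any two edges of `F` are tightly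
connected in `H`. -/
def IsTightlyConnected (H : KGraph V k) (F : Finset (Finset V)) : Prop :=
  F ⊆ H.edges ∧ ∀ e ∈ F, ∀ f ∈ F, H.TightConn e f

/-- `K` is (the edge set of) a tight component: a maximal tightly connected subgraph. -/
def IsTightComponent (H : KGraph V k) (K : Finset (Finset V)) : Prop :=
  Maximal H.IsTightlyConnected K

/-- A monochromatic tight component: a tight component of `H^red` or of `H^blue`. -/
def IsMonoTightComponent (H : KGraph V k) (χ : Finset V → Colour) (K : Finset (Finset V)) :
    Prop :=
  ∃ c : Colour, (H.ofColour χ c).IsTightComponent K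

/-- A matching in `H`: a set of pairwise disjoint edges. -/
def IsMatching (H : KGraph V k) (M : Finset (Finset V)) : Prop :=
  M ⊆ H.edges ∧ ∀ e ∈ M, ∀ f ∈ M, e ≠ f → Disjoint e f

/-- A monochromatic tightly connected matching: for some colour `c`, a matching in `H^c` that is
tightly connected in `H^c`. -/
def IsMonoTightMatching (H : KGraph V k) (χ : Finset V → Colour) (M : Finset (Finset V)) : Prop :=
  ∃ c : Colour, (H.ofColour χ c).IsMatching M ∧ (H.ofColour χ c).IsTightlyConnected M

/-- A fractional matching of `H`; only the values of `ω` on the edges of `H` matter. -/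
def IsFracMatching (H : KGraph V k) (ω : Finset V → ℝ) : Prop :=
  (∀ e ∈ H.edges, 0 ≤ ω e ∧ ω e ≤ 1) ∧
    ∀ v : V, ∑ e ∈ H.edges.filter (fun e => v ∈ e), ω e ≤ 1

/-- The weight of a fractional matching. -/
def weight (H : KGraph V k) (ω : Finset V → ℝ) : ℝ := ∑ e ∈ H.edges, ω e

end KGraph

/-- The set of vertices covered by a set of edges. -/
def coveredBy {V : Type*} [DecidableEq V] (M : Finset (Finset V)) : Finset V := M.biUnion id

/-- `μ_k^s(β, ε, n)`: the largest `m` such that every `2`-edge-coloured `(1 - ε, ε)`-dense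
`k`-graph on `n` vertices has a fractional matching of weight `m` all of whose edges of non-zero
weight have weight at least `β` and lie in `s` monochromatic tight components. (It is `⊤` when no
such `k`-graph exists.) -/
noncomputable def muFin (k s : ℕ) (β ε : ℝ) (n : ℕ) : EReal :=
  sSup ((fun m : ℝ => (m : EReal)) '' {m : ℝ |
    ∀ (H : KGraph (Fin n) k) (χ : Finset (Fin n) → Colour), H.IsDense (1 - ε) ε →
      ∃ (ω : Finset (Fin n) → ℝ) (K : Fin s → Finset (Finset (Fin n))),
        H.IsFracMatching ω ∧ H.weight ω = m ∧
        (∀ j, H.IsMonoTightComponent χ (K j)) ∧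
        ∀ e ∈ H.edges, ω e ≠ 0 → β ≤ ω e ∧ ∃ j, e ∈ K j})

/-- `μ_k^s(β) = liminf_{ε → 0} liminf_{n → ∞} μ_k^s(β, ε, n) / n`. -/
noncomputable def muLim (k s : ℕ) (β : ℝ) : EReal :=
  liminf (fun ε : ℝ => liminf (fun n : ℕ => muFin k s β ε n / (n : EReal)) atTop) (𝓝[>] 0)

/-- A non-decreasing function `(0, 1] → (0, 1]`, as in the definition of the hierarchy `a ≪ b`:
a statement holds for `0 < a ≪ b ≤ 1` if for some such `f` it holds whenever `a, b ∈ (0, 1]` and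
`a ≤ f b`. -/
def IsHierarchyFun (f : ℝ → ℝ) : Prop :=
  Set.MapsTo f (Set.Ioc 0 1) (Set.Ioc 0 1) ∧ MonotoneOn f (Set.Ioc 0 1)

/-! Label each edge by its monochromatic tight component, so that edges of one colour sharing four
vertices have one label. The link of a triple (the pairs completing it to an edge) is an almost
complete two-coloured graph, so it has a giant monochromatic component; the edges it yields share a
label, and the triple inherits that colour and label. After deleting few faces, triples of one
colour that share two vertices have the same label, so the same step leads from triples to vertices
(`exists_compatOn_lower`). Any two vertices count as adjacent, hence only two labels survive, one
for each colour: `Lam .red` and `Lam .blue`.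

Two maximal matchings use up the edges with these labels. In the leftover set `W`, a triple with the
colour of one of its vertices cannot lie in an edge of that colour, since the label would pass from
vertex to triple to edge; all edges through it in `W` have the other colour. From this, after a
small loss, the edges of some colour in `W` all have one label (`IsBlueprint.exists_label`). A third
maximal matching exhausts that colour; what remains is monochromatic, hence has one label, and a
fourth matching finishes (`IsBlueprint.exists_matchings`).

The bound on `muLim` follows by giving weight 1 to edges of the four matchings. -/

/-! ### Giant monochromatic components in almost complete graphs. -/

open Finset in
/-- In an almost complete graph whose edges are coloured red and blue, some monochromatic
component misses only few vertices. -/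
theorem exists_giant_component {V : Type*} [Fintype V] [DecidableEq V]
    (r : Colour → V → V → Prop) (hsymm : ∀ c x y, r c x y → r c y x) (X : Finset V) (δ : ℝ)
    (hδ : 7 * δ < 1) (hn : 0 < Fintype.card V)
    (hX : (#Xᶜ : ℝ) ≤ δ * Fintype.card V) [∀ c x y, Decidable (r c x y)]
    (hr : ∀ x ∈ X, (#{y | ¬ r .red x y ∧ ¬ r .blue x y} : ℝ) ≤ δ * Fintype.card V) :
    ∃ c, ∃ x₀ ∈ X, ∃ A : Finset V, (∀ y ∈ A, Relation.ReflTransGen (r c) x₀ y) ∧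
      (#Aᶜ : ℝ) ≤ 3 * δ * Fintype.card V := by
  classical
  set n : ℝ := (Fintype.card V : ℝ) with hn'
  have hn0 : 0 < n := by simpa [hn'] using hn
  let C : V → Finset V := fun x => univ.filter fun y => Relation.ReflTransGen (r .red) x y
  let Nb : V → Finset V := fun x => univ.filter fun y => ¬ r .red x y ∧ ¬ r .blue x y
  have hNb : ∀ x ∈ X, (#(Nb x) : ℝ) ≤ δ * n := hr
  have pick : ∀ T S : Finset V, (#S : ℝ) < #T → ∃ z ∈ T, z ∉ S := fun T S h =>
    exists_mem_notMem_of_card_lt_card (by exact_mod_cast h)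
  have hun : ∀ S T : Finset V, (#(S ∪ T) : ℝ) ≤ #S + #T := fun S T => by
    exact_mod_cast card_union_le S T
  -- `C x` is the red component of `x`. If one is large, either it nearly exhausts `X`, or no red
  -- edge leaves it and blue connects `X` across the cut. If all are small, blue connects any two
  -- vertices of `X` by a path of length two.
  by_cases h : ∃ x ∈ X, 2 * δ * n < #(X ∩ C x)
  · obtain ⟨x, hx, hxC⟩ := h
    by_cases h2 : (#(X \ C x) : ℝ) ≤ 2 * δ * n
    · refine ⟨.red, x, hx, C x, fun y hy => by simpa [C] using hy, ?_⟩
      have : (C x)ᶜ ⊆ Xᶜ ∪ X \ C x := by intro y; simp; tauto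
      have := (Nat.cast_le (α := ℝ)).2 (card_le_card this)
      linarith [hun Xᶜ (X \ C x)]
    · push Not at h2
      have key : ∀ a ∈ C x, ∀ b ∉ C x, ¬ r .red a b := by
        intro a ha b hb hab
        simp only [C, mem_filter, mem_univ, true_and] at ha hb
        exact hb (ha.tail hab)
      have hC : ∀ y ∈ X ∩ C x, Relation.ReflTransGen (r .blue) x y := by
        intro y hy
        rw [mem_inter] at hy
        obtain ⟨z, hz, hz'⟩ := pick (X \ C x) (Nb x ∪ Nb y)
          (by linarith [hun (Nb x) (Nb y), hNb x hx, hNb y hy.1])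
        rw [Finset.mem_sdiff] at hz
        have h1 : ¬ r .red x z := key x (by simp [C, Relation.ReflTransGen.refl]) z hz.2
        have h2 : ¬ r .red y z := key y hy.2 z hz.2
        simp only [Nb, mem_union, mem_filter, mem_univ, true_and] at hz'
        exact (Relation.ReflTransGen.single (by tauto)).tail (hsymm _ y z (by tauto))
      refine ⟨.blue, x, hx, X, fun y hy => ?_, by nlinarith [(Nat.cast_nonneg (#Xᶜ) : (0:ℝ) ≤ _)]⟩
      by_cases hyC : y ∈ C x
      · exact hC y (mem_inter.2 ⟨hy, hyC⟩)
      · obtain ⟨z, hz, hz'⟩ := pick (X ∩ C x) (Nb y)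
          (by nlinarith [hNb y hy, (Nat.cast_nonneg (#Xᶜ) : (0:ℝ) ≤ _)])
        refine (hC z hz).tail (hsymm _ _ _ ?_)
        have h2 : ¬ r .red y z := fun h => key z (mem_inter.1 hz).2 y hyC (hsymm _ _ _ h)
        simp only [Nb, mem_filter, mem_univ, true_and] at hz'
        tauto
  · push Not at h
    have hU : (#(univ : Finset V) : ℝ) = n := by simp [hn', card_univ]
    obtain ⟨x, -, hx⟩ := pick univ Xᶜ (by nlinarith)
    have hx : x ∈ X := by simpa using hx
    refine ⟨.blue, x, hx, X, fun y hy => ?_, by nlinarith [(Nat.cast_nonneg (#Xᶜ) : (0:ℝ) ≤ _)]⟩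
    -- The excluded sets have total size at most `(1 + 2 + 2 + 1 + 1) * δ * n`, whence the
    -- hypothesis `7 * δ < 1`.
    obtain ⟨z, -, hz⟩ := pick univ (Xᶜ ∪ ((X ∩ C x) ∪ (X ∩ C y)) ∪ (Nb x ∪ Nb y)) (by
      have := hun (Xᶜ ∪ ((X ∩ C x) ∪ (X ∩ C y))) (Nb x ∪ Nb y)
      have := hun Xᶜ ((X ∩ C x) ∪ (X ∩ C y))
      have := hun (X ∩ C x) (X ∩ C y)
      have := hun (Nb x) (Nb y)
      have := h x hx
      have := h y hy
      have := hNb x hx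
      have := hNb y hy
      have : 7 * δ * n < 1 * n := by gcongr
      linarith)
    have hred : ∀ a, z ∉ C a → ¬ r .red a z := fun a ha hh =>
      ha (by simpa [C] using Relation.ReflTransGen.single hh)
    have h1 := hred x
    have h2 := hred y
    simp only [Nb, mem_union, mem_inter, mem_compl, mem_filter, mem_univ, true_and] at hz
    exact (Relation.ReflTransGen.single (by tauto)).tail (hsymm _ y z (by tauto))

/-! ### Full complexes and their cleaning. -/

/-- A simplicial complex, given by its faces, in which each face with fewer than five vertices
extends to a larger face by all but a `δ`-fraction of the vertices. -/
structure IsFullComplex {V : Type*} [Fintype V] [DecidableEq V] (D : Finset (Finset V))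
    (δ : ℝ) : Prop where
  empty_mem : ∅ ∈ D
  down : ∀ S ∈ D, ∀ T ⊆ S, T ∈ D
  ext : ∀ S ∈ D, S.card < 5 →
    ((Finset.univ.filter fun v => insert v S ∉ D).card : ℝ) ≤ δ * Fintype.card V

theorem IsFullComplex.mono {V : Type*} [Fintype V] [DecidableEq V] {D : Finset (Finset V)}
    {δ δ' : ℝ} (h : IsFullComplex D δ) (hδ : δ ≤ δ') : IsFullComplex D δ' :=
  ⟨h.empty_mem, h.down, fun S hS hc => (h.ext S hS hc).trans (by gcongr)⟩

open Finset in
/-- A family of few `i`-sets can be avoided by passing to a full subcomplex. -/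
theorem exists_fullComplex_avoiding.{u} (i : ℕ) : ∀ δ' : ℝ, 0 < δ' → ∃ γ : ℝ, 0 < γ ∧
    ∀ (V : Type u) [Fintype V] [DecidableEq V] [Nonempty V] (D Bad : Finset (Finset V)),
      IsFullComplex D γ → (∀ S ∈ Bad, #S = i) →
      (#Bad : ℝ) ≤ γ * (Fintype.card V : ℝ) ^ i →
      ∃ D' ⊆ D, IsFullComplex D' δ' ∧ ∀ S ∈ Bad, S ∉ D' := by
  induction i with
  | zero =>
    intro δ' hδ'
    -- Fewer than one bad set means none.
    refine ⟨min δ' (1 / 2), by positivity, fun V _ _ _ D Bad hD hB hc => ?_⟩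
    refine ⟨D, Subset.rfl, hD.mono (min_le_left _ _), ?_⟩
    have : (#Bad : ℝ) < 1 := by
      have := min_le_right δ' (1 / 2 : ℝ)
      rw [pow_zero, mul_one] at hc
      linarith
    have : #Bad = 0 := by
      have : #Bad < 1 := by exact_mod_cast this
      omega
    simp [card_eq_zero.1 this]
  | succ i ih =>
    intro δ' hδ'
    obtain ⟨γ₁, hγ₁, H⟩ := ih (δ' / 2) (by positivity)
    -- A face with at most four vertices has at most 16 subsets of size `i`, and each may spoil `κ *
    -- n` extensions: `16 * κ = δ' / 2`.
    set κ : ℝ := δ' / 32 with hκ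
    have hκ0 : 0 < κ := by positivity
    refine ⟨min γ₁ (γ₁ * κ / (i + 1)), by positivity, fun V _ _ _ D Bad hD hB hc => ?_⟩
    set n : ℝ := (Fintype.card V : ℝ) with hn
    have hn0 : 0 < n := by simpa [hn] using Fintype.card_pos (α := V)
    -- The `i`-sets in too many bad sets are few by double counting, so the induction removes them.
    -- Deleting every face that contains a bad set then costs each remaining face few extensions.
    let Bad' : Finset (Finset V) := (powersetCard i univ).filter
      fun S => κ * n < #(Bad.filter fun T => S ⊆ T)
    have hBad' : (#Bad' : ℝ) ≤ γ₁ * n ^ i := by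
      have h1 : (#Bad' : ℝ) * (κ * n) ≤ #Bad * ((i + 1 : ℕ) : ℝ) := by
        have e := sum_card_bipartiteAbove_eq_sum_card_bipartiteBelow
          (s := Bad') (t := Bad) (fun S T => S ⊆ T)
        calc (#Bad' : ℝ) * (κ * n) = ∑ S ∈ Bad', κ * n := by simp
          _ ≤ ∑ S ∈ Bad', (#(Bad.bipartiteAbove (fun S T => S ⊆ T) S) : ℝ) :=
            sum_le_sum fun S hS => (mem_filter.1 hS).2.le
          _ = ∑ T ∈ Bad, (#(Bad'.bipartiteBelow (fun S T => S ⊆ T) T) : ℝ) := by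
            exact_mod_cast e
          _ ≤ ∑ T ∈ Bad, ((i + 1 : ℕ) : ℝ) := by
            refine sum_le_sum fun T hT => ?_
            have : Bad'.bipartiteBelow (fun S T => S ⊆ T) T ⊆ powersetCard i T := by
              intro S hS
              simp only [bipartiteBelow, mem_filter, Bad', mem_powersetCard] at hS
              exact mem_powersetCard.2 ⟨hS.2, hS.1.1.2⟩
            have := card_le_card this
            rw [card_powersetCard, hB T hT, Nat.choose_succ_self_right] at this
            exact_mod_cast this
          _ = _ := by rw [sum_const, nsmul_eq_mul]
      have h2 : (#Bad : ℝ) ≤ γ₁ * κ / (i + 1) * n ^ (i + 1) :=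
        hc.trans (by gcongr; exact min_le_right _ _)
      have h3 : (#Bad' : ℝ) * (κ * n) ≤ γ₁ * n ^ i * (κ * n) := by
        refine h1.trans ((mul_le_mul_of_nonneg_right h2 (by positivity)).trans (le_of_eq ?_))
        push_cast
        field_simp
        ring
      exact le_of_mul_le_mul_right h3 (by positivity)
    obtain ⟨D₁, hD₁, hfull, hav⟩ := H V D Bad' (hD.mono (min_le_left _ _))
      (fun S hS => (mem_powersetCard.1 (mem_filter.1 hS).1).2) hBad'
    refine ⟨D₁.filter fun S => ∀ T ⊆ S, T ∉ Bad, (filter_subset _ _).trans hD₁,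
      ⟨?_, ?_, ?_⟩, fun S hS hS' => (mem_filter.1 hS').2 S Subset.rfl hS⟩
    · refine mem_filter.2 ⟨hfull.empty_mem, fun T hT hTB => ?_⟩
      have := hB T hTB
      rw [subset_empty.1 hT] at this
      simp at this
    · intro S hS T hT
      rw [mem_filter] at hS ⊢
      exact ⟨hfull.down S hS.1 T hT, fun U hU => hS.2 U (hU.trans hT)⟩
    · intro S hS hS5
      rw [mem_filter] at hS
      have hsub : (univ.filter fun v => insert v S ∉ D₁.filter fun S => ∀ T ⊆ S, T ∉ Bad) ⊆
          (univ.filter fun v => insert v S ∉ D₁) ∪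
          (powersetCard i S).biUnion fun T => univ.filter fun v => v ∉ T ∧ insert v T ∈ Bad := by
        intro v hv
        simp only [mem_filter, mem_univ, true_and, not_and, not_forall, not_not, mem_union,
          mem_biUnion, mem_powersetCard] at hv ⊢
        by_cases hvD : insert v S ∈ D₁
        · obtain ⟨T, hT, hTB⟩ := hv hvD
          have hvT : v ∈ T := by
            by_contra hvT
            exact hS.2 T ((subset_insert_iff_of_notMem hvT).1 hT) hTB
          refine .inr ⟨T.erase v, ⟨subset_insert_iff.1 hT, ?_⟩, notMem_erase _ _, ?_⟩
          · rw [card_erase_of_mem hvT, hB T hTB]; rfl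
          · rwa [insert_erase hvT]
        · exact .inl hvD
      have hT : ∀ T ∈ powersetCard i S,
          (#(univ.filter fun v => v ∉ T ∧ insert v T ∈ Bad) : ℝ) ≤ κ * n := by
        intro T hT
        rw [mem_powersetCard] at hT
        have h1 : #(univ.filter fun v => v ∉ T ∧ insert v T ∈ Bad) ≤
            #(Bad.filter fun U => T ⊆ U) := by
          refine card_le_card_of_injOn (fun v => insert v T) ?_ ?_
          · intro v hv
            simp only [coe_filter, mem_univ, true_and, Set.mem_ofPred_eq] at hv ⊢
            exact ⟨hv.2, subset_insert _ _⟩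
          · intro v hv w hw hvw
            simp only [coe_filter, mem_univ, true_and, Set.mem_ofPred_eq] at hv hw
            exact (insert_inj hv.1).1 hvw
        have h2 : T ∉ Bad' := fun h => hav T h (hfull.down S hS.1 T hT.1)
        have h3 : ¬ (κ * n < #(Bad.filter fun U => T ⊆ U)) := fun h =>
          h2 (mem_filter.2 ⟨mem_powersetCard.2 ⟨subset_univ _, hT.2⟩, h⟩)
        exact (Nat.cast_le.2 h1).trans (not_lt.1 h3)
      have h16 : (#(powersetCard i S) : ℝ) ≤ 16 := by
        have : #(powersetCard i S) ≤ 2 ^ #S := by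
          rw [card_powersetCard]; exact Nat.choose_le_two_pow _ _
        have : 2 ^ #S ≤ 2 ^ 4 := Nat.pow_le_pow_right (by norm_num) (by omega)
        have : #(powersetCard i S) ≤ 16 := by omega
        exact_mod_cast this
      calc _ ≤ (#((univ.filter fun v => insert v S ∉ D₁) ∪ (powersetCard i S).biUnion fun T =>
              univ.filter fun v => v ∉ T ∧ insert v T ∈ Bad) : ℝ) := by
            exact_mod_cast card_le_card hsub
        _ ≤ #(univ.filter fun v => insert v S ∉ D₁) + #((powersetCard i S).biUnion fun T =>
              univ.filter fun v => v ∉ T ∧ insert v T ∈ Bad) := by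
            exact_mod_cast card_union_le _ _
        _ ≤ δ' / 2 * n + ∑ T ∈ powersetCard i S,
              (#(univ.filter fun v => v ∉ T ∧ insert v T ∈ Bad) : ℝ) := by
            gcongr
            · exact hfull.ext S hS.1 hS5
            · exact_mod_cast card_biUnion_le
        _ ≤ δ' / 2 * n + #(powersetCard i S) * (κ * n) := by
            gcongr
            simpa using sum_le_card_nsmul _ _ _ hT
        _ ≤ δ' / 2 * n + 16 * (κ * n) := by gcongr
        _ = δ' * n := by rw [hκ]; ring

/-! ### Passing colours and labels to smaller faces. -/

/-- On the `s`-element faces of `D`, the labelling `ℓ` is constant along tight steps between faces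
of the same colour. -/
def CompatOn {V Λ : Type*} [DecidableEq V] (D : Finset (Finset V)) (s : ℕ)
    (χ : Finset V → Colour) (ℓ : Finset V → Λ) : Prop :=
  ∀ e ∈ D, ∀ f ∈ D, e.card = s → f.card = s → s ≤ (e ∩ f).card + 1 → χ e = χ f → ℓ e = ℓ f

open Finset in
/-- The link of an `s`-face `e` has a large monochromatic component `A`, and the faces of that
colour which meet it all carry the same label. -/
theorem exists_giant_link {V Λ : Type*} [Fintype V] [DecidableEq V] {D : Finset (Finset V)}
    {δ : ℝ} {s : ℕ} {χ : Finset V → Colour} {ℓ : Finset V → Λ}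
    (hD : IsFullComplex D δ) (hδ : 14 * δ < 1) (hn : 5 ≤ δ * Fintype.card V) (hs : s ≤ 3)
    (hc : CompatOn D (s + 2) χ ℓ) {e : Finset V} (he : e ∈ D) (hes : #e = s) :
    ∃ (c : Colour) (lam : Λ) (A : Finset V), (#Aᶜ : ℝ) ≤ 6 * δ * Fintype.card V ∧
      ∀ x ∈ A, (∃ h ∈ D, #h = s + 2 ∧ insert x e ⊆ h ∧ #(insert x e) = s + 1 ∧ χ h = c ∧
          ℓ h = lam) ∧
        ∀ h ∈ D, #h = s + 2 → insert x e ⊆ h → χ h = c → ℓ h = lam := by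
  classical
  set n : ℝ := (Fintype.card V : ℝ) with hn'
  have hn0 : 0 < n := by
    rcases (Nat.cast_nonneg (Fintype.card V) : (0 : ℝ) ≤ _).eq_or_lt with h | h
    · rw [hn', ← h] at hn; norm_num at hn
    · exact h
  have hδ0 : 0 < δ := by
    by_contra h
    nlinarith
  have hun : ∀ S T : Finset V, (#(S ∪ T) : ℝ) ≤ #S + #T := fun S T => by
    exact_mod_cast card_union_le S T
  -- This is the coloured link graph of `e`; the cardinality condition rules out loops and vertices
  -- of `e`.
  let r : Colour → V → V → Prop := fun c x y =>
    insert x (insert y e) ∈ D ∧ #(insert x (insert y e)) = s + 2 ∧ χ (insert x (insert y e)) = c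
  have hsymm : ∀ c x y, r c x y → r c y x := by
    intro c x y h
    simp only [r, insert_comm y x]
    exact h
  let X : Finset V := univ.filter fun x => insert x e ∈ D ∧ x ∉ e
  have hX : (#Xᶜ : ℝ) ≤ 2 * δ * n := by
    have h1 : Xᶜ ⊆ (univ.filter fun v => insert v e ∉ D) ∪ e := by
      intro x; simp [X]; tauto
    have h2 := (Nat.cast_le (α := ℝ)).2 (card_le_card h1)
    have h3 := hD.ext e he (by omega)
    have h4 : (#e : ℝ) ≤ 3 := by exact_mod_cast hes.trans_le hs
    linarith [hun (univ.filter fun v => insert v e ∉ D) e]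
  have hr : ∀ x ∈ X, (#{y | ¬ r .red x y ∧ ¬ r .blue x y} : ℝ) ≤ 2 * δ * n := by
    intro x hx
    simp only [X, mem_filter, mem_univ, true_and] at hx
    have hcx : #(insert x e) = s + 1 := by rw [card_insert_of_notMem hx.2, hes]
    have h1 : (univ.filter fun y => ¬ r .red x y ∧ ¬ r .blue x y) ⊆
        (univ.filter fun v => insert v (insert x e) ∉ D) ∪ insert x e := by
      intro y hy
      simp only [mem_filter, mem_univ, true_and, mem_union] at hy ⊢
      by_contra! hcon
      have h1 : insert x (insert y e) ∈ D := by rw [insert_comm]; exact hcon.1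
      have h2 : #(insert x (insert y e)) = s + 2 := by
        rw [insert_comm, card_insert_of_notMem hcon.2, hcx]
      cases hcol : χ (insert x (insert y e))
      · exact hy.1 ⟨h1, h2, hcol⟩
      · exact hy.2 ⟨h1, h2, hcol⟩
    have h2 := (Nat.cast_le (α := ℝ)).2 (card_le_card h1)
    have h3 := hD.ext (insert x e) hx.1 (by omega)
    have h4 : (#(insert x e) : ℝ) ≤ 4 := by rw [hcx]; exact_mod_cast Nat.succ_le_succ hs
    linarith [hun (univ.filter fun v => insert v (insert x e) ∉ D) (insert x e)]
  -- The doubled `δ` absorbs the at most four vertices of the face itself, as `5 ≤ δ * n`.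
  obtain ⟨c, x₀, hx₀, A, hA, hAc⟩ := exists_giant_component r hsymm X (2 * δ) (by linarith)
    (Nat.cast_pos.1 hn0) hX hr
  have hgt : ∃ a ∈ A, a ≠ x₀ := by
    by_contra! h
    have h1 : A ⊆ {x₀} := fun a ha => mem_singleton.2 (h a ha)
    have h2 := card_le_card h1
    have h3 : #A + #Aᶜ = Fintype.card V := card_add_card_compl A
    have h4 : (#A : ℝ) + #Aᶜ = n := by rw [hn']; exact_mod_cast h3
    have h5 : (#A : ℝ) ≤ 1 := by exact_mod_cast h2
    nlinarith
  obtain ⟨a, ha, hax⟩ := hgt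
  obtain ⟨x₁, h01⟩ : ∃ x₁, r c x₀ x₁ := by
    rcases (hA a ha).cases_head with h | ⟨b, hb, -⟩
    · exact absurd h.symm hax
    · exact ⟨b, hb⟩
  -- Link edges sharing a vertex come from faces sharing `s + 1` vertices, so labels propagate along
  -- the component.
  have hface : ∀ x y z, r c x y → r c x z →
      ℓ (insert x (insert y e)) = ℓ (insert x (insert z e)) := by
    intro x y z hy hz
    refine hc _ hy.1 _ hz.1 hy.2.1 hz.2.1 ?_ (hy.2.2.trans hz.2.2.symm)
    have h1 : insert x e ⊆ insert x (insert y e) ∩ insert x (insert z e) := by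
      intro w; simp; tauto
    have h2 := card_le_card h1
    have h3 : #(insert x (insert y e)) ≤ #(insert x e) + 1 := by
      rw [insert_comm]; exact card_insert_le _ _
    have := hy.2.1
    omega
  have main : ∀ x, Relation.ReflTransGen (r c) x₀ x →
      ∀ z, r c x z → ℓ (insert x (insert z e)) = ℓ (insert x₀ (insert x₁ e)) := by
    intro x hx
    induction hx with
    | refl => exact fun z hz => hface _ _ _ hz h01
    | tail _ hbc ih =>
      intro z hz
      rw [hface _ _ _ hz (hsymm _ _ _ hbc), insert_comm, ih _ hbc]
  have hext : ∀ x ∈ A, ∃ z, r c x z := by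
    intro x hx
    rcases (hA x hx).cases_tail with h | ⟨b, -, hb⟩
    · exact h ▸ ⟨x₁, h01⟩
    · exact ⟨b, hsymm _ _ _ hb⟩
  refine ⟨c, ℓ (insert x₀ (insert x₁ e)), A, by linarith, fun x hx => ?_⟩
  obtain ⟨z, hz⟩ := hext x hx
  have hcx : #(insert x e) = s + 1 := by
    have h3 : #(insert x (insert z e)) ≤ #(insert x e) + 1 := by
      rw [insert_comm]; exact card_insert_le _ _
    have := hz.2.1
    have := card_insert_le x e
    omega
  refine ⟨⟨_, hz.1, hz.2.1, ?_, hcx, hz.2.2, main x (hA x hx) z hz⟩, fun h hh hhs hxe hχ => ?_⟩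
  · rw [insert_comm]; exact subset_insert _ _
  · obtain ⟨y, hy⟩ : ∃ y, h = insert y (insert x e) := by
      obtain ⟨y, hy⟩ := card_eq_one.1 (show #(h \ insert x e) = 1 by
        rw [card_sdiff_of_subset hxe]; omega)
      refine ⟨y, ?_⟩
      rw [← sdiff_union_of_subset hxe, hy]
      rfl
    rw [insert_comm] at hy
    subst hy
    exact main x (hA x hx) y ⟨hh, hhs, hχ⟩

open Finset in
/-- From colours and compatible labels of the `(t+3)`-faces to colours and compatible labels of the
`(t+1)`-faces, on a subcomplex. -/
theorem exists_compatOn_lower.{u, w} (t : ℕ) (ht : t ≤ 2) : ∀ δ' : ℝ, 0 < δ' → ∃ γ : ℝ, 0 < γ ∧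
    ∀ (V : Type u) (Λ : Type w) [Fintype V] [DecidableEq V] [Nonempty V]
      (D : Finset (Finset V)) (χ : Finset V → Colour) (ℓ : Finset V → Λ),
      IsFullComplex D γ → 5 ≤ γ * Fintype.card V → CompatOn D (t + 3) χ ℓ →
      ∃ D' ⊆ D, IsFullComplex D' δ' ∧ ∃ (c : Finset V → Colour) (L : Finset V → Λ),
        (∀ h ∈ D', #h = t + 3 → ∀ e ⊆ h, #e = t + 1 → χ h = c e → ℓ h = L e) ∧
        CompatOn D' (t + 1) c L := by
  intro δ' hδ'
  obtain ⟨γ₂, hγ₂, clean₂⟩ := exists_fullComplex_avoiding.{u} (t + 1) δ' hδ'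
  obtain ⟨γ₁, hγ₁, clean₁⟩ := exists_fullComplex_avoiding.{u} (t + 2) (γ₂ / 8) (by positivity)
  refine ⟨min (1 / 20) (γ₁ / 6), by positivity, fun V Λ _ _ _ D χ ℓ hD hn hcomp => ?_⟩
  classical
  set γ : ℝ := min (1 / 20) (γ₁ / 6) with hγ
  have hγ20 : γ ≤ 1 / 20 := min_le_left _ _
  have hγ6 : γ ≤ γ₁ / 6 := min_le_right _ _
  have hγ0 : 0 < γ := by positivity
  set n : ℝ := (Fintype.card V : ℝ) with hn'
  have hn0 : 0 ≤ n := Nat.cast_nonneg _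
  have hun : ∀ S T : Finset V, (#(S ∪ T) : ℝ) ≤ #S + #T := fun S T => by
    exact_mod_cast card_union_le S T
  have hpow : ∀ i, (#(powersetCard i (univ : Finset V)) : ℝ) ≤ n ^ i := by
    intro i
    rw [card_powersetCard, card_univ, hn']
    exact_mod_cast Nat.choose_le_pow _ _
  have : Nonempty Λ := ⟨ℓ ∅⟩
  have : Nonempty Colour := ⟨.red⟩
  have hlink := fun e (he : e ∈ D) (hes : #e = t + 1) =>
    exists_giant_link hD (by linarith) hn (by omega) hcomp he hes
  choose! c L A hA hAx using hlink
  -- Each `(t+1)`-face takes the colour and label of its giant link component. The `(t+2)`-faces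
  -- that leave this component are removed.
  let Bad₁ : Finset (Finset V) := (D.filter fun e => #e = t + 1).biUnion fun e =>
    ((A e)ᶜ \ e).image fun x => insert x e
  obtain ⟨D₁, hD₁, hfull₁, hav₁⟩ := clean₁ V D Bad₁ (hD.mono (by linarith)) (by
      intro S hS
      simp only [Bad₁, mem_biUnion, mem_filter, mem_image, Finset.mem_sdiff] at hS
      obtain ⟨e, he, x, hx, rfl⟩ := hS
      rw [card_insert_of_notMem hx.2, he.2]) (by
      have h1 : (#Bad₁ : ℝ) ≤ ∑ e ∈ D.filter (fun e => #e = t + 1), 6 * γ * n := by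
        refine (Nat.cast_le.2 card_biUnion_le).trans ?_
        push_cast
        refine sum_le_sum fun e he => ?_
        rw [mem_filter] at he
        refine le_trans ?_ (hA e he.1 he.2)
        exact_mod_cast card_image_le.trans (card_le_card sdiff_subset)
      rw [sum_const, nsmul_eq_mul] at h1
      have h2 : (#(D.filter fun e => #e = t + 1) : ℝ) ≤ n ^ (t + 1) := by
        refine le_trans (Nat.cast_le.2 (card_le_card fun e he => ?_)) (hpow (t + 1))
        exact mem_powersetCard.2 ⟨subset_univ _, (mem_filter.1 he).2⟩
      calc (#Bad₁ : ℝ) ≤ n ^ (t + 1) * (6 * γ * n) := h1.trans (by gcongr)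
        _ = 6 * γ * n ^ (t + 2) := by ring
        _ ≤ γ₁ * n ^ (t + 2) := by gcongr; linarith)
  have hmeet : ∀ g ∈ D₁, #g = t + 2 → ∀ e ⊆ g, #e = t + 1 →
      (∃ h ∈ D, #h = t + 3 ∧ g ⊆ h ∧ χ h = c e ∧ ℓ h = L e) ∧
        ∀ h ∈ D, #h = t + 3 → g ⊆ h → χ h = c e → ℓ h = L e := by
    intro g hg hgc e heg hec
    have heD : e ∈ D := hD.down g (hD₁ hg) e heg
    obtain ⟨x, hx⟩ := card_eq_one.1 (show #(g \ e) = 1 by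
      rw [card_sdiff_of_subset heg]; omega)
    have hge : g = insert x e := by
      rw [← sdiff_union_of_subset heg, hx]
      rfl
    have hxe : x ∉ e := (Finset.mem_sdiff.1 (hx ▸ mem_singleton_self x : x ∈ g \ e)).2
    have hxA : x ∈ A e := by
      by_contra hxA
      refine hav₁ g ?_ hg
      simp only [Bad₁, mem_biUnion, mem_filter, mem_image, Finset.mem_sdiff, mem_compl]
      exact ⟨e, ⟨heD, hec⟩, x, ⟨hxA, hxe⟩, hge.symm⟩
    obtain ⟨⟨h, h1, h2, h3, -, h5⟩, h6⟩ := hAx e heD hec x hxA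
    exact ⟨⟨h, h1, h2, hge ▸ h3, h5⟩, hge ▸ h6⟩
  -- The giant component of `e` supplies a face `h` above `g` of colour `c e`; `h` also lies above
  -- `e'` and has its colour, so `h` carries both labels.
  have hshare : ∀ g ∈ D₁, #g = t + 2 → ∀ e ⊆ g, #e = t + 1 → ∀ e' ⊆ g, #e' = t + 1 →
      c e = c e' → L e = L e' := by
    intro g hg hgc e he hec e' he' hec' hcc
    obtain ⟨h, h1, h2, h3, h4, h5⟩ := (hmeet g hg hgc e he hec).1
    rw [← h5]
    exact (hmeet g hg hgc e' he' hec').2 h h1 h2 h3 (h4.trans hcc)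
  let Z : Finset V → Colour → Finset V := fun f c' =>
    univ.filter fun z => z ∉ f ∧ insert z f ∈ D₁ ∧ c (insert z f) = c'
  -- Removing the `(t+1)`-faces whose colour is rare around one of their `t`-subsets ensures that
  -- every colour that occurs around a `t`-set is frequent there.
  let Bad₂ : Finset (Finset V) := (powersetCard t univ).biUnion fun f =>
    ({.red, .blue} : Finset Colour).biUnion fun c' =>
      if (#(Z f c') : ℝ) ≤ γ₂ / 2 * n then (Z f c').image fun z => insert z f else ∅
  obtain ⟨D₂, hD₂, hfull₂, hav₂⟩ := clean₂ V D₁ Bad₂ (hfull₁.mono (by linarith)) (by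
      intro S hS
      simp only [Bad₂, mem_biUnion, mem_powersetCard] at hS
      obtain ⟨f, hf, c', -, hS⟩ := hS
      split_ifs at hS
      · obtain ⟨z, hz, rfl⟩ := mem_image.1 hS
        rw [card_insert_of_notMem (mem_filter.1 hz).2.1, hf.2]
      · simp at hS) (by
      have h1 : (#Bad₂ : ℝ) ≤ ∑ f ∈ powersetCard t (univ : Finset V), γ₂ * n := by
        refine (Nat.cast_le.2 card_biUnion_le).trans ?_
        push_cast
        refine sum_le_sum fun f hf => ?_
        refine (Nat.cast_le.2 card_biUnion_le).trans ?_
        push_cast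
        have h2 : ∀ c' ∈ ({.red, .blue} : Finset Colour),
            (#(if (#(Z f c') : ℝ) ≤ γ₂ / 2 * n then (Z f c').image fun z => insert z f else ∅)
              : ℝ) ≤ γ₂ / 2 * n := by
          intro c' _
          split_ifs with h
          · exact (Nat.cast_le.2 card_image_le).trans h
          · simp only [card_empty, Nat.cast_zero]; positivity
        refine (sum_le_card_nsmul _ _ _ h2).trans (le_of_eq ?_)
        rw [card_pair (by decide)]
        ring
      rw [sum_const, nsmul_eq_mul] at h1
      calc (#Bad₂ : ℝ) ≤ n ^ t * (γ₂ * n) := h1.trans (by gcongr; exact hpow t)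
        _ = γ₂ * n ^ (t + 1) := by ring)
  refine ⟨D₂, hD₂.trans hD₁, hfull₂, c, L, fun h hh hhc e heh hec hχ => ?_, ?_⟩
  · obtain ⟨g, heg, hgh, hg⟩ := exists_subsuperset_card_eq heh (show #e ≤ t + 2 by omega)
      (show t + 2 ≤ #h by omega)
    exact (hmeet g (hfull₁.down h (hD₂ hh) g hgh) hg e heg hec).2 h (hD₁ (hD₂ hh)) hhc hgh hχ
  · intro e he e' he' hec hec' hint hcc
    by_cases hee : e = e'
    · rw [hee]
    have hf : #(e ∩ e') = t := by
      by_contra hne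
      have h1 := card_le_card (inter_subset_left (s₁ := e) (s₂ := e'))
      have h2 : e ∩ e' = e := eq_of_subset_of_card_le inter_subset_left (by omega)
      have h3 : e ∩ e' = e' := eq_of_subset_of_card_le inter_subset_right (by omega)
      exact hee (h2.symm.trans h3)
    set f := e ∩ e' with hfdef
    have hfe : f ⊆ e := inter_subset_left
    have hfe' : f ⊆ e' := inter_subset_right
    have hZ : γ₂ / 2 * n < #(Z f (c e)) := by
      by_contra hlt
      obtain ⟨x, hx⟩ := card_eq_one.1 (show #(e \ f) = 1 by
        rw [card_sdiff_of_subset hfe]; omega)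
      have hex : insert x f = e := by
        rw [← sdiff_union_of_subset hfe, hx]
        rfl
      have hxf : x ∉ f := (Finset.mem_sdiff.1 (hx ▸ mem_singleton_self x : x ∈ e \ f)).2
      refine hav₂ e (mem_biUnion.2 ⟨f, mem_powersetCard.2 ⟨subset_univ _, hf⟩,
        mem_biUnion.2 ⟨c e, by cases c e <;> simp, ?_⟩⟩) he
      rw [if_pos (not_lt.1 hlt)]
      exact mem_image.2 ⟨x, mem_filter.2 ⟨mem_univ _, hxf, by rw [hex]; exact hD₂ he,
        by rw [hex]⟩, hex⟩
    -- At most `γ₂ / 4 * n` vertices fail to extend `e` or `e'`, fewer than `Z f (c e)` has. So some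
    -- `z` gives `insert z f` the common colour and extends both, and `hshare` compares each with
    -- `insert z f`.
    have hb := hfull₁.ext e (hD₂ he) (by omega)
    have hb' := hfull₁.ext e' (hD₂ he') (by omega)
    obtain ⟨z, hz, hzn⟩ := exists_mem_notMem_of_card_lt_card (t := Z f (c e))
      (s := (univ.filter fun v => insert v e ∉ D₁) ∪ univ.filter fun v => insert v e' ∉ D₁) (by
        have h := hun (univ.filter fun v => insert v e ∉ D₁) (univ.filter fun v => insert v e' ∉ D₁)
        have h2 : 0 ≤ γ₂ * n := by positivity
        have : (#((univ.filter fun v => insert v e ∉ D₁) ∪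
          univ.filter fun v => insert v e' ∉ D₁) : ℝ) < #(Z f (c e)) := by linarith
        exact_mod_cast this)
    simp only [mem_union, mem_filter, mem_univ, true_and, not_or, not_not] at hzn
    simp only [Z, mem_filter, mem_univ, true_and] at hz
    have step : ∀ a, f ⊆ a → #a = t + 1 → insert z a ∈ D₁ → c a = c e → L a = L (insert z f) := by
      intro a hfa hac hza hca
      have hzf : #(insert z f) = t + 1 := by rw [card_insert_of_notMem hz.1, hf]
      by_cases hz' : z ∈ a
      · rw [eq_of_subset_of_card_le (insert_subset hz' hfa) (by omega)]
      · exact hshare (insert z a) hza (by rw [card_insert_of_notMem hz', hac]) a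
          (subset_insert _ _) hac _ (insert_subset_insert z hfa) hzf (hca.trans hz.2.2.symm)
    exact (step e hfe hec hzn.1 rfl).trans (step e' hfe' hec' hzn.2 hcc.symm).symm

theorem Colour.eq_of_ne {a b c : Colour} (ha : a ≠ c) (hb : b ≠ c) : a = b := by
  cases a <;> cases b <;> cases c <;> simp_all

/-! ### Edges that avoid the two labels of the blueprint. -/

section Blueprint

variable {V Λ : Type*} [Fintype V] [DecidableEq V] {D : Finset (Finset V)} {δ : ℝ}
  {χ c₃ : Finset V → Colour} {ℓ L₃ : Finset V → Λ} {c₁ : V → Colour} {Lam : Colour → Λ}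
  {W W₁ W₂ : Finset V}

open Finset

/-- Two small faces have a common new vertex in any large set by which both extend. -/
theorem IsFullComplex.exists_extend_two (hD : IsFullComplex D δ) (hn : 1 ≤ δ * Fintype.card V)
    (hW : 10 * δ * Fintype.card V < #W) {S T : Finset V} (hS : S ∈ D) (hT : T ∈ D)
    (hS4 : #S ≤ 4) (hT4 : #T ≤ 4) :
    ∃ w ∈ W, w ∉ S ∧ w ∉ T ∧ insert w S ∈ D ∧ insert w T ∈ D := by
  have hun : ∀ S T : Finset V, (#(S ∪ T) : ℝ) ≤ #S + #T := fun S T => by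
    exact_mod_cast card_union_le S T
  have h1 := hD.ext S hS (by omega)
  have h2 := hD.ext T hT (by omega)
  have h3 : (#S : ℝ) ≤ 4 := by exact_mod_cast hS4
  have h4 : (#T : ℝ) ≤ 4 := by exact_mod_cast hT4
  obtain ⟨w, hw, hwn⟩ := exists_mem_notMem_of_card_lt_card (t := W)
    (s := (S ∪ T) ∪ ((univ.filter fun v => insert v S ∉ D) ∪ univ.filter fun v => insert v T ∉ D))
    (by
      have h5 := hun (S ∪ T)
        ((univ.filter fun v => insert v S ∉ D) ∪ univ.filter fun v => insert v T ∉ D)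
      have h6 := hun S T
      have h7 := hun (univ.filter fun v => insert v S ∉ D) (univ.filter fun v => insert v T ∉ D)
      have : (#((S ∪ T) ∪ ((univ.filter fun v => insert v S ∉ D) ∪
        univ.filter fun v => insert v T ∉ D)) : ℝ) < #W := by linarith
      exact_mod_cast this)
  simp only [mem_union, mem_filter, mem_univ, true_and, not_or, not_not] at hwn
  exact ⟨w, hw, hwn.1.1, hwn.1.2, hwn.2.1, hwn.2.2⟩

theorem IsFullComplex.exists_edge (hD : IsFullComplex D δ) (hn : 1 ≤ δ * Fintype.card V)
    (hW : 10 * δ * Fintype.card V < #W) {S : Finset V} (hS : S ∈ D) (hSW : S ⊆ W)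
    (hS5 : #S ≤ 5) : ∃ h ∈ D, #h = 5 ∧ S ⊆ h ∧ h ⊆ W := by
  obtain ⟨k, hk⟩ := Nat.exists_eq_add_of_le hS5
  induction k generalizing S with
  | zero => exact ⟨S, hS, by omega, Subset.rfl, hSW⟩
  | succ k ih =>
    obtain ⟨w, hw, hwS, -, hwD, -⟩ := hD.exists_extend_two hn hW hS hS (by omega) (by omega)
    have hc := card_insert_of_notMem hwS
    obtain ⟨h, h1, h2, h3, h4⟩ := ih hwD (insert_subset hw hSW) (by omega) (by omega)
    exact ⟨h, h1, h2, (subset_insert _ _).trans h3, h4⟩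

/-- A function on certain triples which agrees on triples in a common `4`-face is constant. -/
theorem IsFullComplex.triple_chain {α : Type*} (hD : IsFullComplex D δ)
    (hn : 1 ≤ δ * Fintype.card V)
    (hW₁ : 10 * δ * Fintype.card V < #W₁) (hW₂ : 10 * δ * Fintype.card V < #W₂)
    (hW₁W : W₁ ⊆ W) (hW₂W : W₂ ⊆ W) (Q : Finset V → Prop) (φ : Finset V → α)
    (hadj : ∀ g ∈ D, #g = 4 → g ⊆ W → ∀ e ⊆ g, #e = 3 → Q e → ∀ e' ⊆ g, #e' = 3 → Q e' →
      φ e = φ e')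
    (hQ : ∀ w ∈ W₁, ∀ z ∈ W₂, ∀ p, Q {w, z, p})
    {x v u : V} (hxv : x ≠ v) (hxu : x ≠ u) (hvu : v ≠ u) (hD' : {x, v, u} ∈ D)
    (hW : {x, v, u} ⊆ W) (hQ₀ : Q {x, v, u}) (hQ₁ : ∀ w ∈ W₁, Q {v, u, w})
    (hQ₂ : ∀ w ∈ W₁, ∀ z ∈ W₂, Q {u, w, z})
    {x' v' u' : V} (hxv' : x' ≠ v') (hxu' : x' ≠ u') (hvu' : v' ≠ u') (hD'' : {x', v', u'} ∈ D)
    (hW' : {x', v', u'} ⊆ W) (hQ₀' : Q {x', v', u'}) (hQ₁' : ∀ w ∈ W₁, Q {v', u', w})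
    (hQ₂' : ∀ w ∈ W₁, ∀ z ∈ W₂, Q {u', w, z}) :
    φ {x, v, u} = φ {x', v', u'} := by
  have step : ∀ {a b c d : V}, a ≠ b → a ≠ c → b ≠ c → d ∉ ({a, b, c} : Finset V) →
      insert d {a, b, c} ∈ D → {a, b, c} ⊆ W → d ∈ W → Q {a, b, c} → Q {b, c, d} →
      φ {a, b, c} = φ {b, c, d} ∧ {b, c, d} ∈ D ∧ {b, c, d} ⊆ W := by
    intro a b c d hab hac hbc hd hg haW hdW hq hq'
    have hd' := hd
    simp only [mem_insert, mem_singleton, not_or] at hd'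
    have h3 : #({a, b, c} : Finset V) = 3 := card_eq_three.2 ⟨a, b, c, hab, hac, hbc, rfl⟩
    have h3' : #({b, c, d} : Finset V) = 3 :=
      card_eq_three.2 ⟨b, c, d, hbc, Ne.symm hd'.2.1, Ne.symm hd'.2.2, rfl⟩
    have hsub : ({b, c, d} : Finset V) ⊆ insert d {a, b, c} := by
      intro y; simp only [mem_insert, mem_singleton]; tauto
    have hgW := insert_subset hdW haW
    exact ⟨hadj _ hg (by rw [card_insert_of_notMem hd, h3]) hgW _ (subset_insert _ _) h3 hq _
      hsub h3' hq', hD.down _ hg _ hsub, hsub.trans hgW⟩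
  have hle : ∀ a b c : V, #({a, b, c} : Finset V) ≤ 4 := fun a b c => card_le_three.trans (by simp)
  -- Both triples are shifted by the same new vertices `w`, `z`, `p`, one at a time inside 4-faces,
  -- until both have become `{w, z, p}`.
  obtain ⟨w, hw, hw1, hw2, hw3, hw4⟩ :=
    hD.exists_extend_two hn hW₁ hD' hD'' (hle _ _ _) (hle _ _ _)
  obtain ⟨e1, d1, s1⟩ := step hxv hxu hvu hw1 hw3 hW (hW₁W hw) hQ₀ (hQ₁ w hw)
  obtain ⟨e1', d1', s1'⟩ := step hxv' hxu' hvu' hw2 hw4 hW' (hW₁W hw) hQ₀' (hQ₁' w hw)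
  simp only [mem_insert, mem_singleton, not_or] at hw1 hw2
  obtain ⟨z, hz, hz1, hz2, hz3, hz4⟩ :=
    hD.exists_extend_two hn hW₂ d1 d1' (hle _ _ _) (hle _ _ _)
  obtain ⟨e2, d2, s2⟩ := step hvu (Ne.symm hw1.2.1) (Ne.symm hw1.2.2) hz1 hz3 s1 (hW₂W hz)
    (hQ₁ w hw) (hQ₂ w hw z hz)
  obtain ⟨e2', d2', s2'⟩ := step hvu' (Ne.symm hw2.2.1) (Ne.symm hw2.2.2) hz2 hz4 s1' (hW₂W hz)
    (hQ₁' w hw) (hQ₂' w hw z hz)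
  simp only [mem_insert, mem_singleton, not_or] at hz1 hz2
  obtain ⟨p, hp, hp1, hp2, hp3, hp4⟩ :=
    hD.exists_extend_two hn hW₁ d2 d2' (hle _ _ _) (hle _ _ _)
  obtain ⟨e3, -, -⟩ := step (Ne.symm hw1.2.2) (Ne.symm hz1.2.1) (Ne.symm hz1.2.2) hp1 hp3 s2
    (hW₁W hp) (hQ₂ w hw z hz) (hQ w hw z hz p)
  obtain ⟨e3', -, -⟩ := step (Ne.symm hw2.2.2) (Ne.symm hz2.2.1) (Ne.symm hz2.2.2) hp2 hp4 s2'
    (hW₁W hp) (hQ₂' w hw z hz) (hQ w hw z hz p)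
  rw [e1, e2, e3, e1', e2', e3']

/-- A function on triples which agrees on triples in a common `4`-face is constant. -/
theorem IsFullComplex.triple_const {α : Type*} (hD : IsFullComplex D δ)
    (hn : 1 ≤ δ * Fintype.card V) (hW : 10 * δ * Fintype.card V < #W) (φ : Finset V → α)
    (hadj : ∀ g ∈ D, #g = 4 → g ⊆ W → ∀ e ⊆ g, #e = 3 → ∀ e' ⊆ g, #e' = 3 → φ e = φ e')
    {e e' : Finset V} (he : e ∈ D) (hec : #e = 3) (heW : e ⊆ W)
    (he' : e' ∈ D) (hec' : #e' = 3) (heW' : e' ⊆ W) : φ e = φ e' := by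
  obtain ⟨x, v, u, h1, h2, h3, rfl⟩ := card_eq_three.1 hec
  obtain ⟨x', v', u', h1', h2', h3', rfl⟩ := card_eq_three.1 hec'
  exact hD.triple_chain hn hW hW Subset.rfl Subset.rfl (fun _ => True) φ
    (fun g h1 h2 h3 e h4 h5 _ e' h6 h7 _ => hadj g h1 h2 h3 e h4 h5 e' h6 h7)
    (by simp) h1 h2 h3 he heW trivial (by simp) (by simp) h1' h2' h3' he' heW' trivial
    (by simp) (by simp)

/-- If the edges in `W` through a triple have the same colour, they have the same label. -/
theorem IsFullComplex.star_label (hD : IsFullComplex D δ) (hn : 1 ≤ δ * Fintype.card V)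
    (hW : 10 * δ * Fintype.card V < #W) (hc : CompatOn D 5 χ ℓ) {e : Finset V} (hec : #e = 3)
    (hcol : ∀ h ∈ D, #h = 5 → e ⊆ h → h ⊆ W → ∀ h' ∈ D, #h' = 5 → e ⊆ h' → h' ⊆ W → χ h = χ h')
    {h h' : Finset V} (hh : h ∈ D) (hhc : #h = 5) (heh : e ⊆ h) (hhW : h ⊆ W)
    (hh' : h' ∈ D) (hhc' : #h' = 5) (heh' : e ⊆ h') (hhW' : h' ⊆ W) : ℓ h = ℓ h' := by
  obtain ⟨S, heS, hSh, hS⟩ := exists_subsuperset_card_eq heh (show #e ≤ 4 by omega)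
    (show 4 ≤ #h by omega)
  obtain ⟨S', heS', hSh', hS'⟩ := exists_subsuperset_card_eq heh' (show #e ≤ 4 by omega)
    (show 4 ≤ #h' by omega)
  -- The tight walk is `h`, `insert p S`, `insert p S'`, `h'`; the middle two share `insert p e`.
  obtain ⟨p, hp, hpS, hpS', hpD, hpD'⟩ := hD.exists_extend_two hn hW
    (hD.down h hh S hSh) (hD.down h' hh' S' hSh') hS.le hS'.le
  have c1 : #(insert p S) = 5 := by rw [card_insert_of_notMem hpS, hS]
  have c2 : #(insert p S') = 5 := by rw [card_insert_of_notMem hpS', hS']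
  have w1 : insert p S ⊆ W := insert_subset hp (hSh.trans hhW)
  have w2 : insert p S' ⊆ W := insert_subset hp (hSh'.trans hhW')
  have e1 : e ⊆ insert p S := heS.trans (subset_insert _ _)
  have e2 : e ⊆ insert p S' := heS'.trans (subset_insert _ _)
  have i1 := card_le_card (subset_inter hSh (subset_insert p S))
  have i2 := card_le_card (subset_inter (insert_subset_insert p heS) (insert_subset_insert p heS'))
  have i3 := card_le_card (subset_inter (subset_insert p S') hSh')
  rw [card_insert_of_notMem (fun h => hpS (heS h))] at i2
  rw [hc h hh _ hpD hhc c1 (by omega) (hcol _ hh hhc heh hhW _ hpD c1 e1 w1),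
    hc _ hpD _ hpD' c1 c2 (by omega) (hcol _ hpD c1 e1 w1 _ hpD' c2 e2 w2),
    hc _ hpD' _ hh' c2 hhc' (by omega) (hcol _ hpD' c2 e2 w2 _ hh' hhc' heh' hhW')]

theorem IsFullComplex.exists_star_label (hD : IsFullComplex D δ) (hn : 1 ≤ δ * Fintype.card V)
    (hW : 10 * δ * Fintype.card V < #W) (hc : CompatOn D 5 χ ℓ) :
    ∃ N : Finset V → Λ, ∀ e, #e = 3 →
      (∀ h ∈ D, #h = 5 → e ⊆ h → h ⊆ W → ∀ h' ∈ D, #h' = 5 → e ⊆ h' → h' ⊆ W → χ h = χ h') →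
      ∀ h ∈ D, #h = 5 → e ⊆ h → h ⊆ W → ℓ h = N e := by
  classical
  refine ⟨fun e => if H : ∃ h ∈ D, #h = 5 ∧ e ⊆ h ∧ h ⊆ W then ℓ H.choose else ℓ ∅,
    fun e he hcol h h1 h2 h3 h4 => ?_⟩
  have H : ∃ h ∈ D, #h = 5 ∧ e ⊆ h ∧ h ⊆ W := ⟨h, h1, h2, h3, h4⟩
  obtain ⟨g1, g2, g3, g4⟩ := H.choose_spec
  simp only [dif_pos H]
  exact hD.star_label hn hW hc he hcol h1 h2 h3 h4 g1 g2 g3 g4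

/-- If all edges in `W` have the same colour, they have the same label. -/
theorem IsFullComplex.label_eq_of_monochromatic (hD : IsFullComplex D δ)
    (hn : 1 ≤ δ * Fintype.card V) (hW : 10 * δ * Fintype.card V < #W) (hc : CompatOn D 5 χ ℓ)
    (hcol : ∀ h ∈ D, #h = 5 → h ⊆ W → ∀ h' ∈ D, #h' = 5 → h' ⊆ W → χ h = χ h')
    {h h' : Finset V} (hh : h ∈ D) (hhc : #h = 5) (hhW : h ⊆ W)
    (hh' : h' ∈ D) (hhc' : #h' = 5) (hhW' : h' ⊆ W) : ℓ h = ℓ h' := by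
  obtain ⟨N, hN⟩ := hD.exists_star_label hn hW hc
  replace hN := fun e he => hN e he
    fun h h1 h2 _ h4 h' h1' h2' _ h4' => hcol h h1 h2 h4 h' h1' h2' h4'
  obtain ⟨e, heh, he⟩ := exists_subset_card_eq (show 3 ≤ #h by omega)
  obtain ⟨e', heh', he'⟩ := exists_subset_card_eq (show 3 ≤ #h' by omega)
  rw [hN e he h hh hhc heh hhW, hN e' he' h' hh' hhc' heh' hhW']
  refine hD.triple_const hn hW N (fun g hg hgc hgW a ha hac b hb hbc => ?_)
    (hD.down h hh e heh) he (heh.trans hhW) (hD.down h' hh' e' heh') he' (heh'.trans hhW')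
  obtain ⟨k, k1, k2, k3, k4⟩ := hD.exists_edge hn hW hg hgW (by omega)
  rw [← hN a hac k k1 k2 (ha.trans k3) k4, ← hN b hbc k k1 k2 (hb.trans k3) k4]

/-- Colours and labels of triples and colours of vertices that control those of the edges. -/
structure IsBlueprint (D : Finset (Finset V)) (χ : Finset V → Colour) (ℓ : Finset V → Λ)
    (c₃ : Finset V → Colour) (L₃ : Finset V → Λ) (c₁ : V → Colour) (Lam : Colour → Λ) :
    Prop where
  compat : CompatOn D 5 χ ℓ
  edge : ∀ h ∈ D, #h = 5 → ∀ e ⊆ h, #e = 3 → χ h = c₃ e → ℓ h = L₃ e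
  compat_triple : CompatOn D 3 c₃ L₃
  triple : ∀ e ∈ D, #e = 3 → ∀ v ∈ e, c₃ e = c₁ v → L₃ e = Lam (c₃ e)

-- If `h` had the colour of `e`, its label would be that of `e`, which is the label `Lam` of that
-- colour because `v` has this colour too; `W` contains no such edge.
omit [Fintype V] in
theorem IsBlueprint.colour_ne (hB : IsBlueprint D χ ℓ c₃ L₃ c₁ Lam)
    (hW : ∀ h ∈ D, #h = 5 → h ⊆ W → ℓ h ≠ Lam (χ h)) {e : Finset V} (he : #e = 3)
    {v : V} (hv : v ∈ e) (hcv : c₃ e = c₁ v) {h : Finset V} (hh : h ∈ D) (hhc : #h = 5)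
    (heh : e ⊆ h) (hhW : h ⊆ W) (hD : ∀ S ∈ D, ∀ T ⊆ S, T ∈ D) : χ h ≠ c₃ e := by
  intro hχ
  refine hW h hh hhc hhW ?_
  rw [hB.edge h hh hhc e heh he hχ, hB.triple e (hD h hh e heh) he v hv hcv, hχ]

/-- A triple of colour `a` lies only in edges of the other colour, which share a label by the star
argument. A triple of the other colour passes its own label to the edges of its colour. Either way a
triple determines the label of the edges through it of colour other than `a`. -/
theorem IsBlueprint.exists_label_of_const (hB : IsBlueprint D χ ℓ c₃ L₃ c₁ Lam)
    (hD : IsFullComplex D δ) (hn : 1 ≤ δ * Fintype.card V)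
    (hWn : 10 * δ * Fintype.card V < #W)
    (hW : ∀ h ∈ D, #h = 5 → h ⊆ W → ℓ h ≠ Lam (χ h)) {a : Colour} (ha : ∀ v ∈ W, c₁ v = a)
    {h h' : Finset V} (hh : h ∈ D) (hhc : #h = 5) (hhW : h ⊆ W) (hχ : χ h ≠ a)
    (hh' : h' ∈ D) (hhc' : #h' = 5) (hhW' : h' ⊆ W) (hχ' : χ h' ≠ a) : ℓ h = ℓ h' := by
  obtain ⟨N, hN⟩ := hD.exists_star_label hn hWn hB.compat
  have hne : ∀ e, #e = 3 → e ⊆ W → c₃ e = a → ∀ h ∈ D, #h = 5 → e ⊆ h → h ⊆ W → χ h ≠ a := by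
    intro e he heW hea h h1 h2 h3 h4
    obtain ⟨v, hv⟩ := card_pos.1 (show 0 < #e by omega)
    have := hB.colour_ne hW he hv (hea.trans (ha v (heW hv)).symm) h1 h2 h3 h4 hD.down
    rwa [hea] at this
  have hN' : ∀ e, #e = 3 → e ⊆ W → c₃ e = a → ∀ h ∈ D, #h = 5 → e ⊆ h → h ⊆ W → ℓ h = N e := by
    intro e he heW hea
    exact hN e he fun h h1 h2 h3 h4 h' h1' h2' h3' h4' =>
      Colour.eq_of_ne (hne e he heW hea h h1 h2 h3 h4) (hne e he heW hea h' h1' h2' h3' h4')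
  let φ : Finset V → Λ := fun e => if c₃ e = a then N e else L₃ e
  have hφ : ∀ e, #e = 3 → ∀ h ∈ D, #h = 5 → e ⊆ h → h ⊆ W → χ h ≠ a → ℓ h = φ e := by
    intro e he h h1 h2 h3 h4 h5
    by_cases hea : c₃ e = a
    · simp only [φ, if_pos hea]
      exact hN' e he (h3.trans h4) hea h h1 h2 h3 h4
    · simp only [φ, if_neg hea]
      exact hB.edge h h1 h2 e h3 he (Colour.eq_of_ne h5 hea)
  obtain ⟨e, heh, he⟩ := exists_subset_card_eq (show 3 ≤ #h by omega)
  obtain ⟨e', heh', he'⟩ := exists_subset_card_eq (show 3 ≤ #h' by omega)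
  rw [hφ e he h hh hhc heh hhW hχ, hφ e' he' h' hh' hhc' heh' hhW' hχ']
  refine hD.triple_const hn hWn φ (fun g hg hgc hgW p hp hpc q hq hqc => ?_)
    (hD.down h hh e heh) he (heh.trans hhW) (hD.down h' hh' e' heh') he' (heh'.trans hhW')
  obtain ⟨k, k1, k2, k3, k4⟩ := hD.exists_edge hn hWn hg hgW (by omega)
  -- An edge of colour `a` excludes triples of colour `a` inside it, so `p` and `q` agree in colour
  -- and, sharing two vertices, in label.
  by_cases hk : χ k = a
  · have hpa : c₃ p ≠ a := fun h =>
      hne p hpc (hp.trans hgW) h k k1 k2 (hp.trans k3) k4 hk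
    have hqa : c₃ q ≠ a := fun h =>
      hne q hqc (hq.trans hgW) h k k1 k2 (hq.trans k3) k4 hk
    simp only [φ, if_neg hpa, if_neg hqa]
    have h1 := card_union_add_card_inter p q
    have h2 := card_le_card (union_subset hp hq)
    exact hB.compat_triple p (hD.down g hg p hp) q (hD.down g hg q hq) hpc hqc (by omega)
      (Colour.eq_of_ne hpa hqa)
  · rw [← hφ p hpc k k1 k2 (hp.trans k3) k4 hk, ← hφ q hqc k k1 k2 (hq.trans k3) k4 hk]

/-- A triple with vertices of both colours shares its colour with one of them, so the edges through
it in `W` have the opposite colour and one label. Shifting such triples shows that colour and label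
do not depend on the triple. -/
theorem IsBlueprint.exists_label_of_mixed (hB : IsBlueprint D χ ℓ c₃ L₃ c₁ Lam)
    (hD : IsFullComplex D δ) (hn : 1 ≤ δ * Fintype.card V)
    (hWn : ∀ c, 10 * δ * Fintype.card V < #(W.filter fun v => c₁ v = c))
    (hW : ∀ h ∈ D, #h = 5 → h ⊆ W → ℓ h ≠ Lam (χ h)) :
    ∃ (b : Colour) (lam : Λ), ∀ h ∈ D, #h = 5 → h ⊆ W → χ h = b → ℓ h = lam := by
  have hWn' : 10 * δ * Fintype.card V < #W := (hWn .red).trans_le (by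
    exact_mod_cast card_le_card (filter_subset _ _))
  let Q : Finset V → Prop := fun e => (∃ v ∈ e, c₁ v = .red) ∧ ∃ v ∈ e, c₁ v = .blue
  have hQ : ∀ e, Q e → ∃ v ∈ e, c₃ e = c₁ v := by
    rintro e ⟨⟨v, hv, hv'⟩, u, hu, hu'⟩
    cases h : c₃ e
    · exact ⟨v, hv, hv'.symm⟩
    · exact ⟨u, hu, hu'.symm⟩
  have hne : ∀ e, #e = 3 → Q e → ∀ h ∈ D, #h = 5 → e ⊆ h → h ⊆ W → χ h ≠ c₃ e := by
    intro e he heQ h h1 h2 h3 h4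
    obtain ⟨v, hv, hcv⟩ := hQ e heQ
    exact hB.colour_ne hW he hv hcv h1 h2 h3 h4 hD.down
  obtain ⟨N, hN⟩ := hD.exists_star_label hn hWn' hB.compat
  have hN' : ∀ e, #e = 3 → Q e → ∀ h ∈ D, #h = 5 → e ⊆ h → h ⊆ W → ℓ h = N e :=
    fun e he heQ => hN e he fun h h1 h2 h3 h4 h' h1' h2' h3' h4' =>
      Colour.eq_of_ne (hne e he heQ h h1 h2 h3 h4) (hne e he heQ h' h1' h2' h3' h4')
  have hrep : ∀ e, #e = 3 → Q e → ∃ x v u, x ≠ v ∧ x ≠ u ∧ v ≠ u ∧ c₁ v = .red ∧ c₁ u = .blue ∧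
      e = {x, v, u} := by
    rintro e he ⟨⟨v, hv, hv'⟩, u, hu, hu'⟩
    have hvu : v ≠ u := by rintro rfl; rw [hv'] at hu'; cases hu'
    obtain ⟨x, hx⟩ := card_eq_one.1 (show #((e.erase v).erase u) = 1 by
      rw [card_erase_of_mem (mem_erase.2 ⟨hvu.symm, hu⟩), card_erase_of_mem hv, he])
    have hxe : x ∈ (e.erase v).erase u := hx ▸ mem_singleton_self x
    rw [mem_erase, mem_erase] at hxe
    refine ⟨x, v, u, hxe.2.1, hxe.1, hvu, hv', hu', ?_⟩
    rw [← insert_erase hv, ← insert_erase (mem_erase.2 ⟨hvu.symm, hu⟩), hx]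
    ext y; simp only [mem_insert, mem_singleton]; tauto
  have hconst : ∀ e ∈ D, #e = 3 → e ⊆ W → Q e → ∀ e' ∈ D, #e' = 3 → e' ⊆ W → Q e' →
      (c₃ e, N e) = (c₃ e', N e') := by
    intro e he hec heW heQ e' he' hec' heW' heQ'
    obtain ⟨x, v, u, h1, h2, h3, h4, h5, rfl⟩ := hrep e hec heQ
    obtain ⟨x', v', u', h1', h2', h3', h4', h5', rfl⟩ := hrep e' hec' heQ'
    refine hD.triple_chain hn (hWn .red) (hWn .blue) (filter_subset _ _) (filter_subset _ _) Q
      (fun e => (c₃ e, N e)) ?_ ?_ h1 h2 h3 he heW heQ ?_ ?_ h1' h2' h3' he' heW' heQ' ?_ ?_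
    · intro g hg hgc hgW a ha hac haQ b hb hbc hbQ
      obtain ⟨k, k1, k2, k3, k4⟩ := hD.exists_edge hn hWn' hg hgW (by omega)
      refine Prod.ext ?_ ?_
      · exact Colour.eq_of_ne (hne a hac haQ k k1 k2 (ha.trans k3) k4).symm
          (hne b hbc hbQ k k1 k2 (hb.trans k3) k4).symm
      · exact (hN' a hac haQ k k1 k2 (ha.trans k3) k4).symm.trans
          (hN' b hbc hbQ k k1 k2 (hb.trans k3) k4)
    · intro w hw z hz p
      exact ⟨⟨w, by simp, (mem_filter.1 hw).2⟩, z, by simp, (mem_filter.1 hz).2⟩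
    · exact fun w hw => ⟨⟨v, by simp, h4⟩, u, by simp, h5⟩
    · exact fun w hw z hz => ⟨⟨w, by simp, (mem_filter.1 hw).2⟩, u, by simp, h5⟩
    · exact fun w hw => ⟨⟨v', by simp, h4'⟩, u', by simp, h5'⟩
    · exact fun w hw z hz => ⟨⟨w, by simp, (mem_filter.1 hw).2⟩, u', by simp, h5'⟩
  -- Replacing one vertex of `h` by a vertex coloured unlike a retained vertex `q` creates a mixed
  -- triple.
  have hnear : ∀ h ∈ D, #h = 5 → h ⊆ W → ∃ k ∈ D, #k = 5 ∧ k ⊆ W ∧ 4 ≤ #(h ∩ k) ∧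
      ∃ e ⊆ k, #e = 3 ∧ Q e := by
    intro h hh hhc hhW
    obtain ⟨q, hq⟩ := card_pos.1 (show 0 < #h by omega)
    obtain ⟨S, hqS, hSh, hS⟩ := exists_subsuperset_card_eq (singleton_subset_iff.2 hq)
      (show #{q} ≤ 4 by simp) (show 4 ≤ #h by omega)
    rw [singleton_subset_iff] at hqS
    obtain ⟨c, hc⟩ : ∃ c, c ≠ c₁ q := by
      cases c₁ q
      · exact ⟨.blue, by simp⟩
      · exact ⟨.red, by simp⟩
    have hSD := hD.down h hh S hSh
    obtain ⟨p, hp, hpS, -, hpD, -⟩ := hD.exists_extend_two hn (hWn c) hSD hSD hS.le hS.le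
    rw [mem_filter] at hp
    have hpc := card_insert_of_notMem hpS
    have hpq : p ≠ q := by rintro rfl; exact hpS hqS
    obtain ⟨e, hpe, hek, he⟩ := exists_subsuperset_card_eq
      (show {p, q} ⊆ insert p S from insert_subset_insert p (singleton_subset_iff.2 hqS))
      (show #{p, q} ≤ 3 by rw [card_pair hpq]; omega) (show 3 ≤ #(insert p S) by omega)
    have hpe' : p ∈ e := hpe (by simp)
    have hqe' : q ∈ e := hpe (by simp)
    refine ⟨insert p S, hpD, by omega, insert_subset hp.1 (hSh.trans hhW),
      hS ▸ card_le_card (subset_inter hSh (subset_insert _ _)), e, hek, he, ?_⟩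
    have hpc := hp.2
    cases hcq : c₁ q <;> rw [hcq] at hc <;> cases c <;> simp at hc
    · exact ⟨⟨q, hqe', hcq⟩, p, hpe', hpc⟩
    · exact ⟨⟨p, hpe', hpc⟩, q, hqe', hcq⟩
  by_cases hex : ∃ e ∈ D, #e = 3 ∧ e ⊆ W ∧ Q e
  · obtain ⟨e, he, hec, heW, heQ⟩ := hex
    obtain ⟨b, hb⟩ : ∃ b, b ≠ c₃ e := by
      cases c₃ e
      · exact ⟨.blue, by simp⟩
      · exact ⟨.red, by simp⟩
    refine ⟨b, N e, fun h hh hhc hhW hχ => ?_⟩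
    obtain ⟨k, k1, k2, k3, k4, e', k5, k6, k7⟩ := hnear h hh hhc hhW
    have := hconst e he hec heW heQ e' (hD.down k k1 e' k5) k6 (k5.trans k3) k7
    rw [Prod.mk.injEq] at this
    have hk := hne e' k6 k7 k k1 k2 k5 k3
    rw [← this.1] at hk
    rw [hB.compat h hh k k1 hhc k2 (by omega) (hχ.trans (Colour.eq_of_ne hb hk)), this.2]
    exact hN' e' k6 k7 k k1 k2 k5 k3
  · refine ⟨.red, ℓ ∅, fun h hh hhc hhW _ => ?_⟩
    obtain ⟨k, k1, k2, k3, k4, e', k5, k6, k7⟩ := hnear h hh hhc hhW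
    exact absurd ⟨e', hD.down k k1 e' k5, k6, k5.trans k3, k7⟩ hex

/-- A set of vertices without edges of the two labels prescribed by the blueprint has a large
subset in which all edges of some colour have the same label. -/
theorem IsBlueprint.exists_label (hB : IsBlueprint D χ ℓ c₃ L₃ c₁ Lam)
    (hD : IsFullComplex D δ) (hn : 1 ≤ δ * Fintype.card V)
    (hWn : 20 * δ * Fintype.card V < #W)
    (hW : ∀ h ∈ D, #h = 5 → h ⊆ W → ℓ h ≠ Lam (χ h)) :
    ∃ W' ⊆ W, (#(W \ W') : ℝ) ≤ 10 * δ * Fintype.card V ∧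
      ∃ (b : Colour) (lam : Λ), ∀ h ∈ D, #h = 5 → h ⊆ W' → χ h = b → ℓ h = lam := by
  by_cases hmix : ∀ c, 10 * δ * Fintype.card V < #(W.filter fun v => c₁ v = c)
  · exact ⟨W, Subset.rfl, by simp only [sdiff_self, bot_eq_empty, card_empty]; push_cast; linarith,
      hB.exists_label_of_mixed hD hn hmix hW⟩
  · push Not at hmix
    obtain ⟨c, hc⟩ := hmix
    obtain ⟨b, hb⟩ : ∃ b, b ≠ c := by
      cases c
      · exact ⟨.blue, by simp⟩
      · exact ⟨.red, by simp⟩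
    have hsd : W \ (W.filter fun v => c₁ v ≠ c) = W.filter fun v => c₁ v = c := by
      ext v; simp only [Finset.mem_sdiff, mem_filter]; tauto
    have hcard : (#(W.filter fun v => c₁ v = c) : ℝ) + #(W.filter fun v => c₁ v ≠ c) = #W := by
      exact_mod_cast card_filter_add_card_filter_not (s := W) (fun v => c₁ v = c)
    -- The rare vertex colour `c` is discarded. The remaining vertices all have colour `b`, and
    -- edges of colour `c` get a common label.
    refine ⟨W.filter fun v => c₁ v ≠ c, filter_subset _ _, by rw [hsd]; exact hc, c, ?_⟩
    have key := fun h h' hh hhc hhW hχ hh' hhc' hhW' hχ' =>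
      hB.exists_label_of_const (W := W.filter fun v => c₁ v ≠ c) (a := b) (h := h) (h' := h')
        hD hn (by linarith) (fun h h1 h2 h3 => hW h h1 h2 (h3.trans (filter_subset _ _)))
        (fun v hv => Colour.eq_of_ne (mem_filter.1 hv).2 hb) hh hhc hhW hχ hh' hhc' hhW' hχ'
    by_cases hex : ∃ h ∈ D, #h = 5 ∧ h ⊆ (W.filter fun v => c₁ v ≠ c) ∧ χ h = c
    · obtain ⟨h, h1, h2, h3, h4⟩ := hex
      exact ⟨ℓ h, fun h' h1' h2' h3' h4' => key h' h h1' h2' h3' (h4' ▸ hb.symm) h1 h2 h3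
        (h4 ▸ hb.symm)⟩
    · exact ⟨ℓ ∅, fun h h1 h2 h3 h4 => absurd ⟨h, h1, h2, h3, h4⟩ hex⟩

end Blueprint

/-! ### Four maximal matchings. -/

section Matching

open Finset

variable {V Λ : Type*} [DecidableEq V]

/-- `M` is a matching inside `U` of `5`-element faces of `D`, all of one colour and one label. -/
structure IsLabelledMatching (D : Finset (Finset V)) (χ : Finset V → Colour) (ℓ : Finset V → Λ)
    (U : Finset V) (M : Finset (Finset V)) : Prop where
  subset : M ⊆ D
  card : ∀ h ∈ M, #h = 5
  inside : ∀ h ∈ M, h ⊆ U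
  disjoint : ∀ e ∈ M, ∀ f ∈ M, e ≠ f → Disjoint e f
  label : ∃ c lam, ∀ h ∈ M, χ h = c ∧ ℓ h = lam

theorem IsLabelledMatching.coveredBy_subset {D : Finset (Finset V)} {χ : Finset V → Colour}
    {ℓ : Finset V → Λ} {U : Finset V} {M : Finset (Finset V)}
    (hM : IsLabelledMatching D χ ℓ U M) : coveredBy M ⊆ U :=
  biUnion_subset.2 hM.inside

omit [DecidableEq V] in
theorem isLabelledMatching_empty (D : Finset (Finset V)) (χ : Finset V → Colour)
    (ℓ : Finset V → Λ) (U : Finset V) : IsLabelledMatching D χ ℓ U ∅ :=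
  ⟨by simp, by simp, by simp, by simp, .red, ℓ ∅, by simp⟩

/-- A largest matching of the given colour and label. -/
theorem exists_maximal_labelledMatching (D : Finset (Finset V)) (χ : Finset V → Colour)
    (ℓ : Finset V → Λ) (U : Finset V) (c : Colour) (lam : Λ) :
    ∃ M, IsLabelledMatching D χ ℓ U M ∧
      ∀ h ∈ D, #h = 5 → h ⊆ U \ coveredBy M → χ h = c → ℓ h ≠ lam := by
  classical
  let F := D.filter fun h => #h = 5 ∧ h ⊆ U ∧ χ h = c ∧ ℓ h = lam
  let 𝓜 := F.powerset.filter fun M => ∀ e ∈ M, ∀ f ∈ M, e ≠ f → Disjoint e f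
  obtain ⟨M, hM, hmax⟩ := exists_max_image 𝓜 card ⟨∅, by simp [𝓜]⟩
  simp only [𝓜, mem_filter, mem_powerset] at hM
  have hF : ∀ h ∈ M, h ∈ D ∧ #h = 5 ∧ h ⊆ U ∧ χ h = c ∧ ℓ h = lam := fun h hh =>
    mem_filter.1 (hM.1 hh)
  refine ⟨M, ⟨fun h hh => (hF h hh).1, fun h hh => (hF h hh).2.1, fun h hh => (hF h hh).2.2.1,
    hM.2, c, lam, fun h hh => (hF h hh).2.2.2⟩, fun h hh hhc hhU hχ hl => ?_⟩
  have hdis : ∀ e ∈ M, Disjoint e h := fun e he =>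
    disjoint_of_subset_left (subset_biUnion_of_mem id he)
      (disjoint_of_subset_right hhU disjoint_sdiff)
  have hhM : h ∉ M := by
    intro hm
    rw [(disjoint_self_iff_empty h).1 (hdis h hm)] at hhc
    simp at hhc
  have := hmax (insert h M) (by
    simp only [𝓜, mem_filter, mem_powerset]
    refine ⟨insert_subset (mem_filter.2 ⟨hh, hhc, hhU.trans sdiff_subset, hχ, hl⟩) hM.1, ?_⟩
    intro e he f hf hef
    rw [mem_insert] at he hf
    rcases he with rfl | he <;> rcases hf with rfl | hf
    · exact absurd rfl hef
    · exact (hdis f hf).symm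
    · exact hdis e he
    · exact hM.2 e he f hf hef)
  rw [card_insert_of_notMem hhM] at this
  omega

theorem IsBlueprint.exists_matchings [Fintype V] {D : Finset (Finset V)} {δ : ℝ}
    {χ c₃ : Finset V → Colour} {ℓ L₃ : Finset V → Λ} {c₁ : V → Colour} {Lam : Colour → Λ}
    (hB : IsBlueprint D χ ℓ c₃ L₃ c₁ Lam) (hD : IsFullComplex D δ)
    (hn : 1 ≤ δ * Fintype.card V) :
    ∃ M : Fin 4 → Finset (Finset V), (∀ j, IsLabelledMatching D χ ℓ univ (M j)) ∧
      (∀ i j, i ≠ j → Disjoint (coveredBy (M i)) (coveredBy (M j))) ∧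
      (#(univ \ univ.biUnion fun j => coveredBy (M j)) : ℝ) ≤ 20 * δ * Fintype.card V := by
  classical
  obtain ⟨M₁, hM₁, hmax₁⟩ := exists_maximal_labelledMatching D χ ℓ univ .red (Lam .red)
  obtain ⟨M₂, hM₂, hmax₂⟩ :=
    exists_maximal_labelledMatching D χ ℓ (univ \ coveredBy M₁) .blue (Lam .blue)
  set W := (univ \ coveredBy M₁) \ coveredBy M₂ with hWdef
  have hun : ∀ S T : Finset V, (#(S ∪ T) : ℝ) ≤ #S + #T := fun S T => by
    exact_mod_cast card_union_le S T
  have hW : ∀ h ∈ D, #h = 5 → h ⊆ W → ℓ h ≠ Lam (χ h) := by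
    intro h h1 h2 h3
    cases hχ : χ h
    · exact hmax₁ h h1 h2 (h3.trans sdiff_subset) hχ
    · exact hmax₂ h h1 h2 h3 hχ
  obtain ⟨M₃, M₄, hM₃, hM₄, hle⟩ : ∃ M₃ M₄, IsLabelledMatching D χ ℓ W M₃ ∧
      IsLabelledMatching D χ ℓ (W \ coveredBy M₃) M₄ ∧
      (#((W \ coveredBy M₃) \ coveredBy M₄) : ℝ) ≤ 20 * δ * Fintype.card V := by
    by_cases hWn : 20 * δ * Fintype.card V < #W
    · obtain ⟨W', hWW', hcard, b, lam, hlab⟩ := hB.exists_label hD hn hWn hW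
      obtain ⟨M₃, hM₃, hmax₃⟩ := exists_maximal_labelledMatching D χ ℓ W' b lam
      have hM₃' : IsLabelledMatching D χ ℓ W M₃ :=
        ⟨hM₃.subset, hM₃.card, fun h hh => (hM₃.inside h hh).trans hWW', hM₃.disjoint, hM₃.label⟩
      set U := W' \ coveredBy M₃ with hU
      have hcol : ∀ h ∈ D, #h = 5 → h ⊆ U → χ h ≠ b := fun h h1 h2 h3 h4 =>
        hmax₃ h h1 h2 h3 h4 (hlab h h1 h2 (h3.trans sdiff_subset) h4)
      by_cases hUn : 10 * δ * Fintype.card V < #U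
      · obtain ⟨h₀, h1, h2, -, h3⟩ :=
          hD.exists_edge hn hUn hD.empty_mem (empty_subset _) (by simp)
        obtain ⟨M₄, hM₄, hmax₄⟩ := exists_maximal_labelledMatching D χ ℓ U (χ h₀) (ℓ h₀)
        refine ⟨M₃, M₄, hM₃', ⟨hM₄.subset, hM₄.card, fun h hh => (hM₄.inside h hh).trans
          (sdiff_subset_sdiff hWW' Subset.rfl), hM₄.disjoint, hM₄.label⟩, ?_⟩
        -- `U` contains no edge of colour `b`, so it is monochromatic and every edge in it has the
        -- label of `h₀`.
        have hno : ∀ h ∈ D, #h = 5 → ¬ h ⊆ U \ coveredBy M₄ := fun h k1 k2 k3 =>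
          hmax₄ h k1 k2 k3
            (Colour.eq_of_ne (hcol h k1 k2 (k3.trans sdiff_subset)) (hcol h₀ h1 h2 h3))
            (hD.label_eq_of_monochromatic hn hUn hB.compat (fun a a1 a2 a3 a' a1' a2' a3' =>
              Colour.eq_of_ne (hcol a a1 a2 a3) (hcol a' a1' a2' a3')) k1 k2
              (k3.trans sdiff_subset) h1 h2 h3)
        have hsmall : (#(U \ coveredBy M₄) : ℝ) ≤ 10 * δ * Fintype.card V := by
          by_contra! hlt
          obtain ⟨h, k1, k2, -, k3⟩ :=
            hD.exists_edge hn hlt hD.empty_mem (empty_subset _) (by simp)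
          exact hno h k1 k2 k3
        have hsub : (W \ coveredBy M₃) \ coveredBy M₄ ⊆ (W \ W') ∪ (U \ coveredBy M₄) := by
          intro v; simp only [hU, mem_union, Finset.mem_sdiff]; tauto
        have := (Nat.cast_le (α := ℝ)).2 (card_le_card hsub)
        linarith [hun (W \ W') (U \ coveredBy M₄)]
      · refine ⟨M₃, ∅, hM₃', isLabelledMatching_empty _ _ _ _, ?_⟩
        have hsub : (W \ coveredBy M₃) \ coveredBy ∅ ⊆ (W \ W') ∪ U := by
          intro v; simp only [hU, mem_union, Finset.mem_sdiff]; tauto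
        have := (Nat.cast_le (α := ℝ)).2 (card_le_card hsub)
        linarith [hun (W \ W') U]
    · refine ⟨∅, ∅, isLabelledMatching_empty _ _ _ _, isLabelledMatching_empty _ _ _ _, ?_⟩
      have := (Nat.cast_le (α := ℝ)).2 (card_le_card (show (W \ coveredBy ∅) \ coveredBy ∅ ⊆ W from
        sdiff_subset.trans sdiff_subset))
      linarith
  have huniv : ∀ {U M}, IsLabelledMatching D χ ℓ U M → IsLabelledMatching D χ ℓ univ M :=
    fun h => ⟨h.subset, h.card, fun _ _ => subset_univ _, h.disjoint, h.label⟩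
  have s2 := hM₂.coveredBy_subset
  have s3 := hM₃.coveredBy_subset
  have s4 := hM₄.coveredBy_subset
  have d12 : Disjoint (coveredBy M₁) (coveredBy M₂) :=
    disjoint_of_subset_right s2 disjoint_sdiff
  have d13 : Disjoint (coveredBy M₁) (coveredBy M₃) :=
    disjoint_of_subset_right (s3.trans sdiff_subset) disjoint_sdiff
  have d23 : Disjoint (coveredBy M₂) (coveredBy M₃) :=
    disjoint_of_subset_right s3 disjoint_sdiff
  have d14 : Disjoint (coveredBy M₁) (coveredBy M₄) :=
    disjoint_of_subset_right (s4.trans (sdiff_subset.trans sdiff_subset)) disjoint_sdiff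
  have d24 : Disjoint (coveredBy M₂) (coveredBy M₄) :=
    disjoint_of_subset_right (s4.trans sdiff_subset) disjoint_sdiff
  have d34 : Disjoint (coveredBy M₃) (coveredBy M₄) :=
    disjoint_of_subset_right s4 disjoint_sdiff
  refine ⟨![M₁, M₂, M₃, M₄], ?_, ?_, ?_⟩
  · intro j
    fin_cases j
    exacts [huniv hM₁, huniv hM₂, huniv hM₃, huniv hM₄]
  · intro i j hij
    fin_cases i <;> fin_cases j <;> first | exact absurd rfl hij | skip
    exacts [d12, d13, d14, d12.symm, d23, d24, d13.symm, d23.symm, d34, d14.symm, d24.symm,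
      d34.symm]
  · refine le_trans ?_ hle
    refine Nat.cast_le.2 (card_le_card fun v hv => ?_)
    simp only [Finset.mem_sdiff, mem_univ, true_and, mem_biUnion, not_exists] at hv
    have h0 := hv 0
    have h1 := hv 1
    have h2 := hv 2
    have h3 := hv 3
    simp only [hWdef, Finset.mem_sdiff, mem_univ, true_and]
    exact ⟨⟨⟨h0, h1⟩, h2⟩, h3⟩

end Matching

/-! ### From dense 5-graphs to full complexes. -/

section Dense

open Finset

variable {V : Type*} [DecidableEq V]

theorem KGraph.TightConn.symm {k : ℕ} {H : KGraph V k} {e f : Finset V} (h : H.TightConn e f) :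
    H.TightConn f e := by
  obtain ⟨h1, h2, h3⟩ := h
  refine ⟨h2, h1, ?_⟩
  induction h3 with
  | refl => exact .refl
  | tail _ hbc ih =>
    exact (ih hbc.1).head ⟨hbc.2.1, hbc.1, by rw [inter_comm]; exact hbc.2.2⟩

theorem KGraph.TightConn.trans {k : ℕ} {H : KGraph V k} {e f g : Finset V}
    (h : H.TightConn e f) (h' : H.TightConn f g) : H.TightConn e g :=
  ⟨h.1, h'.2.1, h.2.2.trans h'.2.2⟩

theorem choose_sub_le (n m j : ℕ) :
    n * (n - m).choose (j + 1) ≤ (n - m) * n.choose (j + 1) := by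
  rcases Nat.eq_zero_or_pos (n - m) with h | h
  · simp [h]
  · obtain ⟨a, ha⟩ := Nat.exists_eq_succ_of_ne_zero h.ne'
    obtain ⟨b, rfl⟩ : ∃ b, n = b + 1 := ⟨n - 1, by omega⟩
    rw [ha]
    refine Nat.le_of_mul_le_mul_right (c := j + 1) ?_ (by omega)
    rw [mul_assoc, mul_assoc, ← Nat.add_one_mul_choose_eq, ← Nat.add_one_mul_choose_eq b j]
    have : a.choose j ≤ b.choose j := Nat.choose_le_choose j (by omega)
    calc (b + 1) * (a.succ * a.choose j) ≤ (b + 1) * (a.succ * b.choose j) := by gcongr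
      _ = a.succ * (b.succ * b.choose j) := by rw [Nat.succ_eq_add_one b]; ring

/-- The sets contained in an edge of a dense `5`-graph form a full complex. -/
theorem KGraph.IsDense.isFullComplex [Fintype V] {H : KGraph V 5} {ε α δ : ℝ}
    (hH : H.IsDense (1 - ε) α) (hε : ε < 1) (hεδ : ε ≤ δ) (hαδ : α ≤ δ)
    (hn : 5 ≤ Fintype.card V) :
    IsFullComplex (univ.filter fun S => S = ∅ ∨ ∃ h ∈ H.edges, S ⊆ h) δ := by
  set n := Fintype.card V with hn'
  have hnR : (0 : ℝ) < n := by exact_mod_cast (by omega : 0 < n)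
  have hchoose : ∀ j ≤ 5, (0 : ℝ) < n.choose j := fun j hj => by
    exact_mod_cast Nat.choose_pos (hj.trans hn)
  have hnb : ∀ S T, T ∈ H.nbhd S → T ∪ S ∈ H.edges := fun S T hT => (mem_filter.1 hT).2
  refine ⟨by simp, ?_, ?_⟩
  · intro S hS T hT
    simp only [mem_filter, mem_univ, true_and] at hS ⊢
    rcases hS with rfl | ⟨h, hh, hSh⟩
    · exact .inl (subset_empty.1 hT)
    · exact .inr ⟨h, hh, hT.trans hSh⟩
  · intro S hS hS5
    simp only [mem_filter, mem_univ, true_and] at hS ⊢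
    rcases S.eq_empty_or_nonempty with rfl | hne
    · obtain ⟨E, hE, hEα, hdeg, -⟩ := hH 1 le_rfl (by norm_num)
      have hsub : (univ.filter fun v : V => ¬ (insert v (∅ : Finset V) = ∅ ∨
          ∃ h ∈ H.edges, insert v ∅ ⊆ h)).card ≤ #E := by
        refine card_le_card_of_injOn (fun v => {v}) (fun v hv => ?_)
          (fun v _ w _ h => singleton_injective h)
        simp only [coe_filter, mem_univ, true_and, Set.mem_ofPred_eq, not_or, not_exists,
          not_and] at hv
        by_contra hvE
        have h1 := hdeg {v} (mem_powersetCard.2 ⟨subset_univ _, card_singleton v⟩) hvE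
        have h2 : (0 : ℝ) < H.deg {v} := lt_of_lt_of_le
          (mul_pos (by linarith) (hchoose 4 (by norm_num))) h1
        obtain ⟨T, hT⟩ := card_pos.1 (show 0 < #(H.nbhd {v}) by exact_mod_cast h2)
        exact hv.2 _ (hnb _ _ hT) (by rw [insert_empty]; exact subset_union_right)
      rw [Nat.choose_one_right] at hEα
      calc _ ≤ (#E : ℝ) := by exact_mod_cast hsub
        _ ≤ α * n := hEα
        _ ≤ δ * n := by gcongr
    · obtain ⟨h, hh, hSh⟩ := hS.resolve_left hne.ne_empty
      have hhc := H.uniform h hh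
      have hi : 1 ≤ #S := hne.card_pos
      obtain ⟨E, hE, -, hdeg, hzero⟩ := hH #S hi hS5
      -- A nonempty face has positive degree, so it is not exceptional and has almost full degree.
      have hSE : S ∉ E := by
        intro hSE
        have h0 : #(H.nbhd S) = 0 := hzero S hSE
        have : h \ S ∈ H.nbhd S := mem_filter.2 ⟨mem_powersetCard.2 ⟨subset_univ _, by
          rw [card_sdiff_of_subset hSh, hhc]⟩, by rwa [sdiff_union_of_subset hSh]⟩
        rw [card_eq_zero.1 h0] at this
        simp at this
      have hd := hdeg S (mem_powersetCard.2 ⟨subset_univ _, rfl⟩) hSE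
      set X := univ.filter fun v => ¬ (insert v S = ∅ ∨ ∃ h ∈ H.edges, insert v S ⊆ h) with hX
      -- No neighbour set of `S` meets `X`. By `choose_sub_le` the degree drops at least by the
      -- factor `1 - #X / n`, which forces `#X ≤ ε * n`.
      have hle : H.deg S ≤ (n - #X).choose (5 - #S) := by
        have : H.nbhd S ⊆ powersetCard (5 - #S) Xᶜ := by
          intro T hT
          have hT' := mem_powersetCard.1 (mem_filter.1 hT).1
          refine mem_powersetCard.2 ⟨fun v hv => ?_, hT'.2⟩
          simp only [hX, mem_compl, mem_filter, mem_univ, true_and, not_not]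
          exact .inr ⟨_, hnb _ _ hT, insert_subset (mem_union_left _ hv) subset_union_right⟩
        have := card_le_card this
        rwa [card_powersetCard, card_compl] at this
      obtain ⟨j, hj⟩ : ∃ j, 5 - #S = j + 1 := ⟨5 - #S - 1, by omega⟩
      rw [hj] at hle hd
      have hXn : #X ≤ n := card_le_univ X
      have h1 : (n : ℝ) * (n - #X).choose (j + 1) ≤ (n - #X) * n.choose (j + 1) := by
        have := choose_sub_le n #X j
        rw [← Nat.cast_sub hXn]
        exact_mod_cast this
      have h2 : (1 - ε) * n.choose (j + 1) ≤ ((n - #X).choose (j + 1) : ℕ) :=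
        hd.trans (by exact_mod_cast hle)
      have hc := hchoose (j + 1) (by omega)
      have h3 : (n * (1 - ε)) * n.choose (j + 1) ≤ (n - #X) * n.choose (j + 1) := by
        calc _ = n * ((1 - ε) * n.choose (j + 1) : ℝ) := by ring
          _ ≤ n * ((n - #X).choose (j + 1) : ℕ) := by gcongr
          _ ≤ _ := h1
      have h4 := le_of_mul_le_mul_right h3 hc
      have : ε * n ≤ δ * n := by gcongr
      linarith

end Dense

/-! ### Assembling the blueprint. -/

open Finset in
/-- Every `2`-edge-coloured dense `5`-graph is almost covered by four disjoint monochromatic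
tightly connected matchings. -/
theorem exists_four_matchings.{u} : ∀ η : ℝ, 0 < η → ∃ γ : ℝ, 0 < γ ∧
    ∀ (V : Type u) [Fintype V] [DecidableEq V] (H : KGraph V 5) (χ : Finset V → Colour)
      (ε α : ℝ), 1 ≤ γ * Fintype.card V → ε ≤ γ → α ≤ γ → H.IsDense (1 - ε) α →
      ∃ M : Fin 4 → Finset (Finset V),
        (∀ j, H.IsMonoTightMatching χ (M j)) ∧
        (∀ i j, i ≠ j → Disjoint (coveredBy (M i)) (coveredBy (M j))) ∧
        (#(univ \ univ.biUnion fun j => coveredBy (M j)) : ℝ) ≤ 3 * η * Fintype.card V := by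
  intro η hη
  obtain ⟨γ₂, hγ₂, low₂⟩ := exists_compatOn_lower.{u, u} 0 (by norm_num) (η / 10) (by positivity)
  obtain ⟨γ₁, hγ₁, low₁⟩ := exists_compatOn_lower.{u, u} 2 (by norm_num) γ₂ hγ₂
  -- The divisions by 5 turn `1 ≤ γ * n` into the size conditions of the two lowering steps and into
  -- `5 ≤ n`.
  refine ⟨min (min (γ₁ / 5) (γ₂ / 5)) (min (η / 10) (1 / 5)), by positivity,
    fun V _ _ H χ ε α hn hε hα hH => ?_⟩
  classical
  set γ := min (min (γ₁ / 5) (γ₂ / 5)) (min (η / 10) (1 / 5)) with hγ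
  have g1 : γ ≤ γ₁ / 5 := (min_le_left _ _).trans (min_le_left _ _)
  have g2 : γ ≤ γ₂ / 5 := (min_le_left _ _).trans (min_le_right _ _)
  have g3 : γ ≤ η / 10 := (min_le_right _ _).trans (min_le_left _ _)
  have g4 : γ ≤ 1 / 5 := (min_le_right _ _).trans (min_le_right _ _)
  have hn0 : (0 : ℝ) ≤ Fintype.card V := Nat.cast_nonneg _
  have k1 : γ * Fintype.card V ≤ γ₁ / 5 * Fintype.card V := by gcongr
  have k2 : γ * Fintype.card V ≤ γ₂ / 5 * Fintype.card V := by gcongr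
  have k3 : γ * Fintype.card V ≤ η / 10 * Fintype.card V := by gcongr
  have k4 : γ * Fintype.card V ≤ 1 / 5 * Fintype.card V := by gcongr
  have hn5 : 5 ≤ Fintype.card V := by
    have : (5 : ℝ) ≤ Fintype.card V := by linarith
    exact_mod_cast this
  have : Nonempty V := Fintype.card_pos_iff.1 (by omega)
  set D₀ : Finset (Finset V) := univ.filter fun S => S = ∅ ∨ ∃ h ∈ H.edges, S ⊆ h with hD₀
  have hfull₀ : IsFullComplex D₀ γ₁ :=
    hH.isFullComplex (by linarith) (by linarith) (by linarith) hn5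
  have hedge : ∀ h ∈ D₀, #h = 5 → h ∈ H.edges := by
    intro h hh hhc
    rcases (mem_filter.1 hh).2 with rfl | ⟨f, hf, hhf⟩
    · simp at hhc
    · rwa [eq_of_subset_of_card_le hhf (by rw [H.uniform f hf, hhc])]
  -- The label of an edge is its monochromatic tight component.
  let ℓ : Finset V → Finset (Finset V) := fun h =>
    H.edges.filter fun f => (H.ofColour χ (χ h)).TightConn h f
  have hcompat : CompatOn D₀ 5 χ ℓ := by
    intro e he f hf hec hfc hint hχ
    have he' : e ∈ (H.ofColour χ (χ e)).edges := mem_filter.2 ⟨hedge e he hec, rfl⟩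
    have hf' : f ∈ (H.ofColour χ (χ e)).edges := mem_filter.2 ⟨hedge f hf hfc, hχ.symm⟩
    have hcon : (H.ofColour χ (χ e)).TightConn e f := by
      by_cases hef : e = f
      · subst hef
        exact ⟨he', he', .refl⟩
      · refine ⟨he', hf', .single ⟨he', hf', ?_⟩⟩
        have h1 := card_le_card (inter_subset_left (s₁ := e) (s₂ := f))
        by_contra hne
        have h2 : e ∩ f = e := eq_of_subset_of_card_le inter_subset_left (by omega)
        have h3 : e ∩ f = f := eq_of_subset_of_card_le inter_subset_right (by omega)
        exact hef (h2.symm.trans h3)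
    refine filter_congr fun g _ => ?_
    rw [← hχ]
    exact ⟨fun h => hcon.symm.trans h, fun h => hcon.trans h⟩
  obtain ⟨D₁, hD₁, hfull₁, c₃, L₃, hed₁, hco₁⟩ := low₁ V _ D₀ χ ℓ hfull₀ (by linarith) hcompat
  obtain ⟨D₂, hD₂, hfull₂, c, L, hed₂, hco₂⟩ := low₂ V _ D₁ c₃ L₃ hfull₁ (by linarith) hco₁
  let Lam : Colour → Finset (Finset V) := fun a =>
    if h : ∃ v : V, {v} ∈ D₂ ∧ c {v} = a then L {h.choose} else ∅
  have hB : IsBlueprint D₂ χ ℓ c₃ L₃ (fun v => c {v}) Lam := by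
    refine ⟨fun e he f hf => hcompat e (hD₁ (hD₂ he)) f (hD₁ (hD₂ hf)),
      fun h hh => hed₁ h (hD₂ hh), fun e he f hf => hco₁ e (hD₂ he) f (hD₂ hf), ?_⟩
    intro e he hec v hv hcv
    have hve := singleton_subset_iff.2 hv
    have hvD := hfull₂.down e he _ hve
    rw [hed₂ e he hec {v} hve (card_singleton v) hcv]
    have hex : ∃ u : V, {u} ∈ D₂ ∧ c {u} = c₃ e := ⟨v, hvD, hcv.symm⟩
    simp only [Lam, dif_pos hex]
    obtain ⟨q1, q2⟩ := hex.choose_spec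
    -- For singletons the intersection condition `1 ≤ 0 + 1` is vacuous, so all vertices of one
    -- colour share a label.
    exact hco₂ _ hvD _ q1 (card_singleton _) (card_singleton _) (by omega) (by rw [q2, hcv])
  obtain ⟨M, hM, hdisj, hcov⟩ := hB.exists_matchings hfull₂ (by linarith)
  refine ⟨M, fun j => ?_, hdisj, hcov.trans (by nlinarith)⟩
  obtain ⟨hsub, hcard, -, hdis, b, lam, hlab⟩ := hM j
  have hmem : ∀ e ∈ M j, e ∈ (H.ofColour χ b).edges := fun e he =>
    mem_filter.2 ⟨hedge e (hD₁ (hD₂ (hsub he))) (hcard e he), (hlab e he).1⟩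
  refine ⟨b, ⟨hmem, hdis⟩, hmem, fun e he f hf => ?_⟩
  have hff : f ∈ ℓ f := mem_filter.2 ⟨(mem_filter.1 (hmem f hf)).1, by
    rw [(hlab f hf).1]; exact ⟨hmem f hf, hmem f hf, .refl⟩⟩
  rw [(hlab f hf).2, ← (hlab e he).2] at hff
  have := (mem_filter.1 hff).2
  rwa [(hlab e he).1] at this

/-! ### Hierarchy functions. -/

/-- A monotone choice of witnesses. -/
theorem exists_isHierarchyFun (P : ℝ → ℝ → Prop) (hP : ∀ η, 0 < η → ∃ γ, 0 < γ ∧ P η γ)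
    (hmono : ∀ η η' γ, η ≤ η' → P η γ → P η' γ)
    (hanti : ∀ η γ γ', γ' ≤ γ → P η γ → P η γ') :
    ∃ f, IsHierarchyFun f ∧ ∀ η α, 0 < η → α ≤ f η → P η α := by
  let S : ℝ → Set ℝ := fun η => {γ | γ ∈ Set.Ioc (0 : ℝ) 1 ∧ P η γ}
  have hne : ∀ η, 0 < η → (S η).Nonempty := by
    intro η hη
    obtain ⟨γ, hγ, hPγ⟩ := hP η hη
    exact ⟨min γ 1, ⟨by positivity, min_le_right _ _⟩, hanti _ _ _ (min_le_left _ _) hPγ⟩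
  have hbdd : ∀ η, BddAbove (S η) := fun η => ⟨1, fun γ hγ => hγ.1.2⟩
  have hpos : ∀ η, 0 < η → 0 < sSup (S η) := by
    intro η hη
    obtain ⟨γ, hγ⟩ := hne η hη
    exact hγ.1.1.trans_le (le_csSup (hbdd η) hγ)
  -- The supremum is monotone but need not be attained; halving leaves an admissible value above.
  refine ⟨fun η => sSup (S η) / 2, ⟨fun η hη => ⟨half_pos (hpos η hη.1), ?_⟩, ?_⟩, ?_⟩
  · have := csSup_le (hne η hη.1) (fun γ hγ => hγ.1.2)
    change sSup (S η) / 2 ≤ 1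
    linarith
  · intro η hη η' hη' hle
    have := csSup_le_csSup (hbdd η') (hne η hη.1)
      (fun γ hγ => ⟨hγ.1, hmono _ _ _ hle hγ.2⟩ : S η ⊆ S η')
    change sSup (S η) / 2 ≤ sSup (S η') / 2
    linarith
  · intro η α hη hα
    obtain ⟨γ, hγ, hlt⟩ := exists_lt_of_lt_csSup (hne η hη)
      (lt_of_le_of_lt hα (half_lt_self (hpos η hη)))
    exact hanti _ _ _ hlt.le hγ.2

theorem isHierarchyFun_id : IsHierarchyFun id :=
  ⟨fun _ h => h, monotone_id.monotoneOn _⟩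

/-! ### Fractional matchings and the limit. -/

section Fractional

open Finset

/-- A tightly connected set of edges extends to a tight component. -/
theorem KGraph.IsTightlyConnected.exists_isTightComponent {V : Type*} [DecidableEq V] {k : ℕ}
    {H : KGraph V k} {F : Finset (Finset V)} (hF : H.IsTightlyConnected F) :
    ∃ K, F ⊆ K ∧ H.IsTightComponent K := by
  classical
  obtain ⟨K, hK, hmax⟩ := exists_max_image
    (H.edges.powerset.filter fun K => F ⊆ K ∧ H.IsTightlyConnected K) card
    ⟨F, mem_filter.2 ⟨mem_powerset.2 hF.1, Subset.rfl, hF⟩⟩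
  rw [mem_filter] at hK
  refine ⟨K, hK.2.1, hK.2.2, fun L hL hKL => ?_⟩
  have := hmax L (mem_filter.2 ⟨mem_powerset.2 hL.1, hK.2.1.trans hKL, hL⟩)
  exact (eq_of_subset_of_card_le hKL this).symm.subset

/-- Disjoint monochromatic tightly connected matchings that cover at least `5 * m` vertices give a
`0`-`1`-valued fractional matching of weight `m`. -/
theorem KGraph.exists_isFracMatching {V : Type*} [DecidableEq V] {s : ℕ} {H : KGraph V 5}
    {χ : Finset V → Colour} {M : Fin s → Finset (Finset V)}
    (hM : ∀ j, H.IsMonoTightMatching χ (M j))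
    (hdisj : ∀ i j, i ≠ j → Disjoint (coveredBy (M i)) (coveredBy (M j))) {m : ℕ}
    (hm : 5 * m ≤ #(univ.biUnion fun j => coveredBy (M j))) :
    ∃ (ω : Finset V → ℝ) (K : Fin s → Finset (Finset V)),
      H.IsFracMatching ω ∧ H.weight ω = m ∧ (∀ j, H.IsMonoTightComponent χ (K j)) ∧
      ∀ e ∈ H.edges, ω e ≠ 0 → 1 ≤ ω e ∧ ∃ j, e ∈ K j := by
  have hK : ∀ j, ∃ K, M j ⊆ K ∧ H.IsMonoTightComponent χ K := by
    intro j
    obtain ⟨c, -, hc⟩ := hM j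
    obtain ⟨K, hK, hK'⟩ := hc.exists_isTightComponent
    exact ⟨K, hK, c, hK'⟩
  choose K hMK hK using hK
  have hedges : ∀ j, ∀ e ∈ M j, e ∈ H.edges := by
    intro j e he
    obtain ⟨c, hc, -⟩ := hM j
    exact (mem_filter.1 (hc.1 he)).1
  set N := univ.biUnion M with hN
  have hNdisj : ∀ e ∈ N, ∀ f ∈ N, e ≠ f → Disjoint e f := by
    intro e he f hf hef
    obtain ⟨i, -, hi⟩ := mem_biUnion.1 he
    obtain ⟨j, -, hj⟩ := mem_biUnion.1 hf
    by_cases hij : i = j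
    · subst hij
      obtain ⟨c, hc, -⟩ := hM i
      exact hc.2 e hi f hj hef
    · exact disjoint_of_subset_left (subset_biUnion_of_mem id hi)
        (disjoint_of_subset_right (subset_biUnion_of_mem id hj) (hdisj i j hij))
  have hmN : m ≤ #N := by
    have h1 : (univ.biUnion fun j => coveredBy (M j)) ⊆ N.biUnion id := by
      intro v hv
      simp only [coveredBy, mem_biUnion, mem_univ, true_and, id, hN] at hv ⊢
      obtain ⟨j, e, he, hve⟩ := hv
      exact ⟨e, ⟨j, he⟩, hve⟩
    have h2 : #(N.biUnion id) ≤ #N * 5 := card_biUnion_le_card_mul _ _ _ fun e he => by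
      obtain ⟨j, -, hj⟩ := mem_biUnion.1 he
      exact (H.uniform e (hedges j e hj)).le
    have := card_le_card h1
    omega
  -- The weight must be exactly `m`, the same for every `H`, so surplus edges are dropped.
  obtain ⟨N', hN', hcard⟩ := exists_subset_card_eq hmN
  have hN'e : ∀ e ∈ N', e ∈ H.edges := fun e he => by
    obtain ⟨j, -, hj⟩ := mem_biUnion.1 (hN' he)
    exact hedges j e hj
  refine ⟨fun e => if e ∈ N' then 1 else 0, K, ⟨fun e _ => ?_, fun v => ?_⟩, ?_, hK,
    fun e _ hne => ?_⟩
  · dsimp only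
    split_ifs <;> norm_num
  · rw [sum_ite_mem, sum_const, nsmul_eq_mul, mul_one]
    have : #(H.edges.filter (fun e => v ∈ e) ∩ N') ≤ 1 := by
      refine card_le_one.2 fun a ha b hb => ?_
      simp only [mem_inter, mem_filter] at ha hb
      by_contra hab
      exact disjoint_left.1 (hNdisj a (hN' ha.2) b (hN' hb.2) hab) ha.1.2 hb.1.2
    exact_mod_cast this
  · rw [KGraph.weight, sum_ite_mem, inter_eq_right.2 hN'e, sum_const, nsmul_eq_mul, mul_one, hcard]
  · have he : e ∈ N' := by
      by_contra h
      simp [h] at hne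
    obtain ⟨j, -, hj⟩ := mem_biUnion.1 (hN' he)
    exact ⟨by simp [he], j, hMK j hj⟩

theorem one_fifth_le_muLim : ((1 / 5 : ℝ) : EReal) ≤ muLim 5 4 1 := by
  refine EReal.ge_of_forall_gt_iff_ge.1 fun c hc => ?_
  rw [EReal.coe_lt_coe_iff] at hc
  set d := 1 / 5 - c with hd
  have hd0 : 0 < d := by linarith
  set η := min d 1 / 3 with hη
  have hη0 : 0 < η := by positivity
  have hηd : 3 * η ≤ d := by rw [hη]; linarith [min_le_left d 1]
  have hη1 : 3 * η ≤ 1 := by rw [hη]; linarith [min_le_right d 1]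
  obtain ⟨γ, hγ, H4⟩ := exists_four_matchings η hη0
  refine le_liminf_of_le (by isBoundedDefault) ?_
  filter_upwards [Ioc_mem_nhdsGT hγ] with ε hε
  refine le_liminf_of_le (by isBoundedDefault) ?_
  have hlarge : ∀ a : ℝ, 0 < a → ∀ᶠ n : ℕ in atTop, 1 ≤ a * n := fun a ha =>
    (tendsto_natCast_atTop_atTop.const_mul_atTop ha).eventually_ge_atTop 1
  -- Since `3 * η ≤ d`, rounding down still leaves `m ≥ c * n` once `(d - d / 5) * n ≥ 1`.
  filter_upwards [hlarge γ hγ, hlarge (4 * d / 5) (by positivity), eventually_gt_atTop 0]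
    with n hn₁ hn₂ hn₀
  have hnR : (0 : ℝ) < n := by exact_mod_cast hn₀
  have hfloor : 0 ≤ (1 - 3 * η) * n / 5 := by
    have : 0 ≤ 1 - 3 * η := by linarith
    positivity
  set m := ⌊(1 - 3 * η) * n / 5⌋₊ with hm
  have hm₁ : (m : ℝ) ≤ (1 - 3 * η) * n / 5 := Nat.floor_le hfloor
  have hm₂ : (1 - 3 * η) * n / 5 < m + 1 := Nat.lt_floor_add_one _
  have hcm : c * n ≤ m := by
    have : 3 * η * n ≤ d * n := by gcongr
    have hc' : c = 1 / 5 - d := by rw [hd]; ring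
    rw [hc']
    linarith
  rw [EReal.le_div_iff_mul_le (by exact_mod_cast hn₀) (EReal.natCast_ne_top n)]
  have hcast : (c : EReal) * (n : EReal) = ((c * n : ℝ) : EReal) := by
    rw [EReal.coe_mul, EReal.coe_natCast]
  rw [hcast]
  refine (EReal.coe_le_coe_iff.2 hcm).trans (le_sSup ⟨m, fun H χ hH => ?_, rfl⟩)
  obtain ⟨M, hM, hdisj, hcov⟩ :=
    H4 (Fin n) H χ ε ε (by rwa [Fintype.card_fin]) hε.2 hε.2 hH
  refine KGraph.exists_isFracMatching hM hdisj ?_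
  rw [Fintype.card_fin] at hcov
  set C := univ.biUnion fun j => coveredBy (M j)
  have h1 : #(univ \ C) + #C = n := by
    rw [card_sdiff_add_card_eq_card (subset_univ C), card_univ, Fintype.card_fin]
  have h2 : (#(univ \ C) : ℝ) + #C = n := by exact_mod_cast h1
  have h3 : (5 * m : ℝ) ≤ #C := by linarith
  exact_mod_cast h3

end Fractional

theorem lemma7p1 :
    (∃ f₁ f₂ f₃ : ℝ → ℝ, IsHierarchyFun f₁ ∧ IsHierarchyFun f₂ ∧ IsHierarchyFun f₃ ∧
      ∀ (n : ℕ) (ε α η : ℝ), 0 < n → 0 < ε → ε ≤ 1 → 0 < α → α ≤ 1 → 0 < η → η < 1 →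
        α ≤ f₁ η → ε ≤ f₂ α → 1 / (n : ℝ) ≤ f₃ ε →
        ∀ (V : Type*) [Fintype V] [DecidableEq V], Fintype.card V = n →
        ∀ (H : KGraph V 5) (χ : Finset V → Colour), H.IsDense (1 - ε) α →
          ∃ M : Fin 4 → Finset (Finset V),
            (∀ j, H.IsMonoTightMatching χ (M j)) ∧
            (∀ i j, i ≠ j → Disjoint (coveredBy (M i)) (coveredBy (M j))) ∧
            (((Finset.univ \ Finset.univ.biUnion fun j => coveredBy (M j)).card : ℕ) : ℝ)
              ≤ 3 * η * (n : ℝ)) ∧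
    ((1 / 5 : ℝ) : EReal) ≤ muLim 5 4 1 := by
  refine ⟨?_, one_fifth_le_muLim⟩
  obtain ⟨f, hf, hP⟩ := exists_isHierarchyFun _ exists_four_matchings
    (fun η η' γ hle h V _ _ H χ ε α hn hε hα hH => by
      obtain ⟨M, h1, h2, h3⟩ := h V H χ ε α hn hε hα hH
      exact ⟨M, h1, h2, h3.trans (by gcongr)⟩)
    (fun η γ γ' hle h V _ _ H χ ε α hn hε hα hH =>
      h V H χ ε α (hn.trans (by gcongr)) (hε.trans hle) (hα.trans hle) hH)
  -- A single threshold bounds `α`, `ε` and `1 / n`, and `1 / n ≤ ε ≤ α` lets `α` itself serve as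
  -- this threshold.
  refine ⟨f, id, id, hf, isHierarchyFun_id, isHierarchyFun_id, ?_⟩
  intro n ε α η hn hε _ hα _ hη _ hαf hεα hnε V _ _ hV H χ hH
  subst hV
  refine hP η α hη hαf V H χ ε α ?_ hεα le_rfl hH
  have hn0 : (0 : ℝ) < Fintype.card V := by exact_mod_cast hn
  exact (div_le_iff₀ hn0).1 (hnε.trans hεα)
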